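/- Let $H$ be a real Hilbert space with norm $\|\cdot\|$, and let $A:D(A)\subset H\to H$ be a strictly positive selfadjoint operator (no compactness assumed), that is, $A$ is selfadjoint and $\langle Ax,x\rangle\ge c\|x\|^2$ on $D(A)$ for some $c>0$. Let $\lambda_1>0$ be the minimum of the spectrum of $A$, let $H^1=D(A^{1/2})$ with $\|x\|_1=\|A^{1/2}x\|$, and let $\mathcal H=H^1\times H^1\times H\times H$. Fix $\alpha,\beta,\gamma,\kappa>0$ with $\mu=\gamma-\alpha\beta\ge 0$, let $\eta\in\mathbb R$, and consider the system $$u_{ttt}+\alpha u_{tt}+\beta Au_t+\gamma Au=\eta A\theta,\qquad \theta_t+\kappa A\theta=-\eta Au_{tt}-\alpha\eta Au_t .$$ A weak solution is a map $t\mapsto(u(t),u_t(t),u_{tt}(t),\theta(t))\in C([0,\infty),\mathcal H)$, where $u_t$ and $u_{tt}$ are derivatives in $H$, such that for every $\varphi\in D(A)$ and $t\ge0$ $$\tfrac{d}{dt}\langle u_{tt},\varphi\rangle+\alpha\langle u_{tt},\varphi\rangle+\beta\langle u_t,A\varphi\rangle+\gamma\langle u,A\varphi\rangle=\eta\langle\theta,A\varphi\rangle,$$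 $$\tfrac{d}{dt}\langle\theta,\varphi\rangle+\kappa\langle\theta,A\varphi\rangle=-\eta\langle u_{tt},A\varphi\rangle-\alpha\eta\langle u_t,A\varphi\rangle .$$ Its energy is $$E(t)=\tfrac12\Big[\|u_t(t)+\alpha u(t)\|_1^2+\|u_{tt}(t)+\alpha u_t(t)\|^2+\|u_t(t)\|_1^2+\|\theta(t)\|^2\Big].$$ Define $$\mathfrak t(\kappa)=\begin{cases}\dfrac{2\kappa}{\alpha^2}\Big(1-\dfrac{\alpha}{\kappa\lambda_1}+\dfrac{\alpha^2}{\kappa^2\lambda_1^2}\Big)&\text{if }\kappa<\alpha/\lambda_1,\\[2mm]\dfrac{2\kappa}{\alpha^2}&\text{if }\kappa\ge\alpha/\lambda_1.\end{cases}$$ If $\eta^2>\mathfrak t(\kappa)\,\mu$, then the system is exponentially stable: for every initial datum in $\mathcal H$ there is exactly one weak solution on $[0,\infty)$ (so that the solution semigroup on $\mathcal H$ is defined), and there are constants $M\ge1$ and $\omega>0$, independent of the initial datum, such that $$E(t)\le M\,E(0)\,e^{-\omega t}\qquad\text{for all }t\ge0$$ along every weak solution. In particular, when $\mu=0$ the system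 is exponentially stable for every $\eta\ne0$. -/

import Mathlib

noncomputable section

namespace MGTFourier

open scoped InnerProductSpace Topology
open Set Filter

variable {H : Type*} [NormedAddCommGroup H] [InnerProductSpace ℝ H]

/-! ### Square roots of bounded operators -/

/-- Visser iteration for `1 - √(1 - b)`. -/
def sqrtIter (b : H →L[ℝ] H) : ℕ → (H →L[ℝ] H)
  | 0 => 0
  | n + 1 => (1 / 2 : ℝ) • (b + sqrtIter b n * sqrtIter b n)

/-- Scalar majorant of the iteration. -/
def sqrtMaj : ℕ → ℝ
  | 0 => 0
  | n + 1 => (1 / 2 : ℝ) * (1 + sqrtMaj n * sqrtMaj n)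

theorem sqrtMaj_bounds (n : ℕ) : 0 ≤ sqrtMaj n ∧ sqrtMaj n ≤ 1 := by
  induction n with
  | zero => simp [sqrtMaj]
  | succ n ih => simp only [sqrtMaj]; constructor <;> nlinarith [ih.1, ih.2]

theorem sqrtIter_commute {b C : H →L[ℝ] H} (h : Commute C b) (n : ℕ) :
    Commute C (sqrtIter b n) := by
  induction n with
  | zero => exact Commute.zero_right C
  | succ n ih => exact (h.add_right (ih.mul_right ih)).smul_right _

theorem sqrtIter_norm_le {b : H →L[ℝ] H} (hb : ‖b‖ ≤ 1) (n : ℕ) :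
    ‖sqrtIter b n‖ ≤ sqrtMaj n := by
  induction n with
  | zero => simp [sqrtIter, sqrtMaj]
  | succ n ih =>
    simp only [sqrtIter, sqrtMaj]
    rw [norm_smul, Real.norm_of_nonneg (by norm_num)]
    have h1 : ‖sqrtIter b n * sqrtIter b n‖ ≤ sqrtMaj n * sqrtMaj n :=
      (norm_mul_le _ _).trans (mul_le_mul ih ih (norm_nonneg _) (sqrtMaj_bounds n).1)
    have := norm_add_le b (sqrtIter b n * sqrtIter b n)
    nlinarith

theorem sqrtIter_dist_le {b : H →L[ℝ] H} (hb : ‖b‖ ≤ 1) (n : ℕ) :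
    ‖sqrtIter b (n + 1) - sqrtIter b n‖ ≤ sqrtMaj (n + 1) - sqrtMaj n := by
  induction n with
  | zero =>
    have := sqrtIter_norm_le hb 1
    simpa [sqrtIter, sqrtMaj] using this
  | succ n ih =>
    have hc : Commute (sqrtIter b (n + 1)) (sqrtIter b n) :=
      sqrtIter_commute (sqrtIter_commute (Commute.refl b) (n + 1)).symm n
    have h1 : sqrtIter b (n + 1 + 1) - sqrtIter b (n + 1) = (1 / 2 : ℝ) •
        ((sqrtIter b (n + 1) + sqrtIter b n) * (sqrtIter b (n + 1) - sqrtIter b n)) := by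
      rw [← hc.mul_self_sub_mul_self_eq]
      conv_lhs => rw [sqrtIter, sqrtIter]
      rw [← smul_sub]
      congr 1
      rw [← sqrtIter]
      abel
    have h2 : sqrtMaj (n + 1 + 1) - sqrtMaj (n + 1) = (1 / 2 : ℝ) *
        ((sqrtMaj (n + 1) + sqrtMaj n) * (sqrtMaj (n + 1) - sqrtMaj n)) := by
      have e1 : sqrtMaj (n + 1 + 1) = (1 / 2 : ℝ) * (1 + sqrtMaj (n + 1) * sqrtMaj (n + 1)) := rfl
      have e2 : sqrtMaj (n + 1) = (1 / 2 : ℝ) * (1 + sqrtMaj n * sqrtMaj n) := rfl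
      rw [e1]
      nlinarith [e2]
    rw [h1, h2, norm_smul, Real.norm_of_nonneg (by norm_num)]
    refine mul_le_mul_of_nonneg_left ((norm_mul_le _ _).trans ?_) (by norm_num)
    exact mul_le_mul
      ((norm_add_le _ _).trans (add_le_add (sqrtIter_norm_le hb _) (sqrtIter_norm_le hb _)))
      ih (norm_nonneg _) (add_nonneg (sqrtMaj_bounds _).1 (sqrtMaj_bounds _).1)

theorem exists_sqrtIter_limit [CompleteSpace H] {b : H →L[ℝ] H} (hb : ‖b‖ ≤ 1) :
    ∃ Y : H →L[ℝ] H, Tendsto (sqrtIter b) atTop (𝓝 Y) := by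
  have hsum : Summable fun n => sqrtMaj (n + 1) - sqrtMaj n := by
    refine summable_of_sum_range_le (c := 1)
      (fun n => (norm_nonneg _).trans (sqrtIter_dist_le (H := H) hb n)) fun n => ?_
    rw [Finset.sum_range_sub]
    linarith [(sqrtMaj_bounds n).2, (sqrtMaj_bounds 0).1]
  have hcau : CauchySeq (sqrtIter b) := by
    refine cauchySeq_of_dist_le_of_summable _ (fun n => ?_) hsum
    rw [dist_comm, dist_eq_norm]
    exact sqrtIter_dist_le hb n
  exact cauchySeq_tendsto_of_complete hcau

theorem sqrtIter_selfAdjoint [CompleteSpace H] {b : H →L[ℝ] H} (hb : IsSelfAdjoint b) (n : ℕ) :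
    IsSelfAdjoint (sqrtIter b n) := by
  induction n with
  | zero => exact IsSelfAdjoint.zero _
  | succ n ih =>
    have h1 : IsSelfAdjoint (sqrtIter b n * sqrtIter b n) := by
      rw [← pow_two]; exact ih.pow 2
    exact (IsSelfAdjoint.all (1 / 2 : ℝ)).smul (hb.add h1)

theorem exists_sqrt_one_sub [CompleteSpace H] {b : H →L[ℝ] H} (hb : ‖b‖ ≤ 1)
    (hbs : IsSelfAdjoint b) :
    ∃ S : H →L[ℝ] H, IsSelfAdjoint S ∧ (∀ x, 0 ≤ ⟪S x, x⟫_ℝ) ∧ S * S = 1 - b ∧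
      ∀ C : H →L[ℝ] H, Commute C b → Commute C S := by
  obtain ⟨Y, hY⟩ := exists_sqrtIter_limit hb
  have hYn : ‖Y‖ ≤ 1 := le_of_tendsto hY.norm
    (Eventually.of_forall fun n => (sqrtIter_norm_le hb n).trans (sqrtMaj_bounds n).2)
  have hfix : Y = (1 / 2 : ℝ) • (b + Y * Y) :=
    tendsto_nhds_unique ((tendsto_add_atTop_iff_nat 1).2 hY)
      (((tendsto_const_nhds (x := b)).add (hY.mul hY)).const_smul (1 / 2 : ℝ))
  have hYs : IsSelfAdjoint Y := by
    have h1 : Tendsto (fun n => star (sqrtIter b n)) atTop (𝓝 (star Y)) :=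
      (continuous_star.tendsto Y).comp hY
    have h2 : Tendsto (sqrtIter b) atTop (𝓝 (star Y)) :=
      h1.congr fun n => (sqrtIter_selfAdjoint hbs n).star_eq
    exact tendsto_nhds_unique h2 hY
  refine ⟨1 - Y, (IsSelfAdjoint.one _).sub hYs, fun x => ?_, ?_, fun C hC => ?_⟩
  · have h1 : ⟪Y x, x⟫_ℝ ≤ ‖x‖ * ‖x‖ := by
      refine (real_inner_le_norm _ _).trans ?_
      refine mul_le_mul_of_nonneg_right ?_ (norm_nonneg _)
      exact (Y.le_opNorm x).trans (by nlinarith [norm_nonneg x])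
    have h2 : ⟪(1 - Y) x, x⟫_ℝ = ‖x‖ * ‖x‖ - ⟪Y x, x⟫_ℝ := by
      rw [← real_inner_self_eq_norm_mul_norm, ← inner_sub_left]; rfl
    rw [h2]; linarith
  · have h2 : Y + Y = b + Y * Y := by
      have h3 : (2 : ℝ) • Y = (2 : ℝ) • ((1 / 2 : ℝ) • (b + Y * Y)) := congrArg _ hfix
      rw [smul_smul, two_smul] at h3
      rw [h3]; norm_num
    have h4 : (1 - Y) * (1 - Y) = 1 - (Y + Y) + Y * Y := by noncomm_ring
    rw [h4, h2]; abel
  · have hCY : Commute C Y :=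
      tendsto_nhds_unique (tendsto_const_nhds.mul hY)
        ((hY.mul tendsto_const_nhds).congr fun n => (sqrtIter_commute hC n).eq.symm)
    exact (Commute.one_right C).sub_right hCY

theorem norm_one_sub_le {T : H →L[ℝ] H} {c : ℝ} (hc : 0 < c)
    (hpos : ∀ x, c * ‖T x‖ ^ 2 ≤ ⟪T x, x⟫_ℝ) : ‖1 - c • T‖ ≤ 1 := by
  refine ContinuousLinearMap.opNorm_le_bound _ zero_le_one fun x => ?_
  rw [one_mul]
  refine le_of_sq_le_sq ?_ (norm_nonneg x)
  have h1 : (1 - c • T) x = x - c • T x := rfl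
  rw [h1, norm_sub_sq_real, norm_smul, inner_smul_right, real_inner_comm,
    Real.norm_of_nonneg hc.le]
  have h2 := mul_le_mul_of_nonneg_left (hpos x) hc.le
  have h3 : 0 ≤ c * (c * ‖T x‖ ^ 2) := by positivity
  nlinarith

theorem exists_sqrt_bounded [CompleteSpace H] {T : H →L[ℝ] H} (hT : IsSelfAdjoint T) {c : ℝ}
    (hc : 0 < c) (hpos : ∀ x, c * ‖T x‖ ^ 2 ≤ ⟪T x, x⟫_ℝ) :
    ∃ S : H →L[ℝ] H, IsSelfAdjoint S ∧ (∀ x, 0 ≤ ⟪S x, x⟫_ℝ) ∧ S * S = T ∧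
      ∀ C : H →L[ℝ] H, Commute C T → Commute C S := by
  obtain ⟨S, hS, hSp, hSS, hSC⟩ := exists_sqrt_one_sub (norm_one_sub_le hc hpos)
    ((IsSelfAdjoint.one _).sub ((IsSelfAdjoint.all c).smul hT))
  have hsc : 0 < Real.sqrt c := Real.sqrt_pos.2 hc
  refine ⟨(Real.sqrt c)⁻¹ • S, (IsSelfAdjoint.all _).smul hS, fun x => ?_, ?_, fun C hC => ?_⟩
  · have h2 : ⟪((Real.sqrt c)⁻¹ • S) x, x⟫_ℝ = (Real.sqrt c)⁻¹ * ⟪S x, x⟫_ℝ :=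
      real_inner_smul_left _ _ _
    rw [h2]
    exact mul_nonneg (inv_nonneg.2 hsc.le) (hSp x)
  · rw [smul_mul_smul_comm, hSS, sub_sub_cancel, smul_smul, ← mul_inv, Real.mul_self_sqrt hc.le,
      inv_mul_cancel₀ hc.ne', one_smul]
  · exact (hSC C ((Commute.one_right C).sub_right (hC.smul_right c))).smul_right _

/-! ### Self-adjoint operators through their graphs -/

theorem graph_mem_of_forall [CompleteSpace H] {A : H →ₗ.[ℝ] H} (hA : IsSelfAdjoint A) {y z : H}
    (h : ∀ x r, (x, r) ∈ A.graph → ⟪z, x⟫_ℝ = ⟪y, r⟫_ℝ) : (y, z) ∈ A.graph := by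
  have hd := hA.dense_domain
  have h1 : ∀ x : A.domain, ⟪z, (x : H)⟫_ℝ = ⟪y, A x⟫_ℝ := fun x => h _ _ (A.mem_graph x)
  have hy : y ∈ A.adjoint.domain := LinearPMap.mem_adjoint_domain_of_exists y ⟨z, h1⟩
  have h2 : A.adjoint ⟨y, hy⟩ = z := LinearPMap.adjoint_apply_eq hd ⟨y, hy⟩ h1
  have h3 : (y, z) ∈ A.adjoint.graph := by
    rw [← h2]; exact A.adjoint.mem_graph ⟨y, hy⟩
  rwa [LinearPMap.isSelfAdjoint_def.1 hA] at h3

theorem graph_symm [CompleteSpace H] {A : H →ₗ.[ℝ] H} (hA : IsSelfAdjoint A) {x r y s : H}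
    (hx : (x, r) ∈ A.graph) (hy : (y, s) ∈ A.graph) : ⟪r, y⟫_ℝ = ⟪x, s⟫_ℝ := by
  have h := LinearPMap.adjoint_isFormalAdjoint (T := A) hA.dense_domain
  rw [LinearPMap.isSelfAdjoint_def.1 hA] at h
  obtain ⟨x', rfl, rfl⟩ := (LinearPMap.mem_graph_iff A).1 hx
  obtain ⟨y', rfl, rfl⟩ := (LinearPMap.mem_graph_iff A).1 hy
  exact h x' y'

theorem isSelfAdjoint_of_graph [CompleteSpace H] {R : H →ₗ.[ℝ] H}
    (hd : Dense (R.domain : Set H))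
    (h1 : ∀ x r y s, (x, r) ∈ R.graph → (y, s) ∈ R.graph → ⟪r, y⟫_ℝ = ⟪x, s⟫_ℝ)
    (h2 : ∀ y z, (∀ x r, (x, r) ∈ R.graph → ⟪z, x⟫_ℝ = ⟪y, r⟫_ℝ) → (y, z) ∈ R.graph) :
    IsSelfAdjoint R := by
  rw [LinearPMap.isSelfAdjoint_def]
  have hf : R.IsFormalAdjoint R := fun x y => h1 _ _ _ _ (R.mem_graph x) (R.mem_graph y)
  refine le_antisymm (LinearPMap.le_of_le_graph ?_) (hf.le_adjoint hd)
  rintro ⟨y, z⟩ hyz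
  obtain ⟨y', rfl, rfl⟩ := (LinearPMap.mem_graph_iff _).1 hyz
  refine h2 _ _ fun x r hx => ?_
  obtain ⟨x', rfl, rfl⟩ := (LinearPMap.mem_graph_iff _).1 hx
  exact LinearPMap.adjoint_isFormalAdjoint hd y' x'

/-- A bijective self-adjoint operator has a bounded self-adjoint inverse. -/
theorem exists_inverse [CompleteSpace H] {A : H →ₗ.[ℝ] H} (hA : IsSelfAdjoint A)
    (hinj : ∀ x, (x, (0 : H)) ∈ A.graph → x = 0) (hsurj : ∀ y, ∃ x, (x, y) ∈ A.graph) :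
    ∃ T : H →L[ℝ] H, IsSelfAdjoint T ∧ ∀ x y, (x, y) ∈ A.graph ↔ x = T y := by
  choose f hf using hsurj
  have huniq : ∀ x x' y, (x, y) ∈ A.graph → (x', y) ∈ A.graph → x = x' := by
    intro x x' y h h'
    have h3 := A.graph.sub_mem h h'
    rw [Prod.mk_sub_mk, sub_self] at h3
    exact sub_eq_zero.1 (hinj _ h3)
  let F : H →ₗ[ℝ] H :=
    { toFun := f
      map_add' := fun a b => huniq _ _ _ (hf _) (A.graph.add_mem (hf a) (hf b))
      map_smul' := fun c a => huniq _ _ _ (hf _) (A.graph.smul_mem c (hf a)) }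
  have hF : F.IsSymmetric := fun a b => (graph_symm hA (hf a) (hf b)).symm
  refine ⟨⟨F, hF.continuous⟩, ContinuousLinearMap.isSelfAdjoint_iff_isSymmetric.2 hF,
    fun x y => ⟨fun h => huniq _ _ _ h (hf y), ?_⟩⟩
  rintro rfl
  exact hf y

/-- A strictly positive self-adjoint operator is onto. -/
theorem surjective_of_strictlyPositive [CompleteSpace H] {A : H →ₗ.[ℝ] H} (hA : IsSelfAdjoint A)
    {c : ℝ} (hc : 0 < c) (hpos : ∀ x : A.domain, c * ‖(x : H)‖ ^ 2 ≤ ⟪A x, (x : H)⟫_ℝ) (y : H) :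
    ∃ x, (x, y) ∈ A.graph := by
  have hclosed : _root_.IsClosed (A.graph : Set (H × H)) := hA.isClosed
  have : CompleteSpace A.graph := hclosed.completeSpace_coe
  have hlow : ∀ p : A.graph, c * ‖p.1.1‖ ≤ ‖p.1.2‖ := by
    rintro ⟨⟨x, r⟩, hx⟩
    obtain ⟨x', rfl, rfl⟩ := (LinearPMap.mem_graph_iff A).1 hx
    have h1 := (hpos x').trans (real_inner_le_norm _ _)
    rcases (norm_nonneg (x' : H)).eq_or_lt with h0 | h0
    · simp [← h0]
    · simp only
      nlinarith
  let L : A.graph →L[ℝ] H := (ContinuousLinearMap.snd ℝ H H).comp A.graph.subtypeL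
  have hL : AntilipschitzWith (Real.toNNReal (1 + c⁻¹)) L := by
    refine ContinuousLinearMap.antilipschitz_of_bound L fun p => ?_
    have hc' : 0 ≤ 1 + c⁻¹ := by positivity
    rw [Real.coe_toNNReal _ hc']
    have h1 : ‖p‖ = max ‖p.1.1‖ ‖p.1.2‖ := rfl
    have h2 : L p = p.1.2 := rfl
    have h3 : ‖p.1.1‖ ≤ c⁻¹ * ‖p.1.2‖ := by
      rw [le_inv_mul_iff₀ hc]; exact hlow p
    have h4 : 0 ≤ c⁻¹ * ‖p.1.2‖ := by positivity
    rw [h1, h2, add_mul, one_mul]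
    exact max_le (by linarith [norm_nonneg p.1.2]) (by linarith)
  have hrc : _root_.IsClosed (Set.range L) := hL.isClosed_range L.uniformContinuous
  have hrange : LinearMap.range (L : A.graph →ₗ[ℝ] H) = ⊤ := by
    have hcl : _root_.IsClosed ((LinearMap.range (L : A.graph →ₗ[ℝ] H) : Submodule ℝ H) : Set H) := by
      exact hrc
    rw [← hcl.submodule_topologicalClosure_eq, Submodule.topologicalClosure_eq_top_iff,
      Submodule.eq_bot_iff]
    intro z hz
    rw [Submodule.mem_orthogonal] at hz
    have h1 : (z, (0 : H)) ∈ A.graph := by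
      refine graph_mem_of_forall hA fun x r hx => ?_
      have h2 := hz r ⟨⟨(x, r), hx⟩, rfl⟩
      rw [inner_zero_left, real_inner_comm]
      exact h2.symm
    have h3 := hlow ⟨_, h1⟩
    simp only [norm_zero] at h3
    have : ‖z‖ ≤ 0 := by
      by_contra h4
      push Not at h4
      nlinarith
    exact norm_le_zero_iff.1 this
  obtain ⟨p, hp⟩ := LinearMap.range_eq_top.1 hrange y
  refine ⟨p.1.1, ?_⟩
  have h5 : p.1.2 = y := hp
  rw [← h5]
  exact p.2

/-- `R` is the positive square root of `A`: it is self-adjoint, positive, and `R ∘ R = A`,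
domains included. -/
def IsPosSqrt [CompleteSpace H] (R A : H →ₗ.[ℝ] H) : Prop :=
  IsSelfAdjoint R ∧ (∀ x : R.domain, 0 ≤ ⟪R x, (x : H)⟫_ℝ) ∧
    ∀ x y : H, (x, y) ∈ A.graph ↔ ∃ z, (x, z) ∈ R.graph ∧ (z, y) ∈ R.graph

/-- A strictly positive self-adjoint operator has exactly one positive square root. -/
theorem existsUnique_posSqrt [CompleteSpace H] {A : H →ₗ.[ℝ] H} (hA : IsSelfAdjoint A)
    (hpos : ∃ c > 0, ∀ x : A.domain, c * ‖(x : H)‖ ^ 2 ≤ ⟪A x, (x : H)⟫_ℝ) :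
    ∃! R : H →ₗ.[ℝ] H, IsPosSqrt R A := by
  obtain ⟨c, hc, hpos⟩ := hpos
  have hinj : ∀ x, (x, (0 : H)) ∈ A.graph → x = 0 := by
    intro x hx
    obtain ⟨x', rfl, h⟩ := (LinearPMap.mem_graph_iff A).1 hx
    have h1 := hpos x'
    simp only at h
    rw [h, inner_zero_left] at h1
    have h2 : ‖(x' : H)‖ ^ 2 ≤ 0 := by
      by_contra h3
      push Not at h3
      nlinarith
    simpa using h2
  obtain ⟨T, hT, hTA⟩ := exists_inverse hA hinj (surjective_of_strictlyPositive hA hc hpos)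
  have hTpos : ∀ y, c * ‖T y‖ ^ 2 ≤ ⟪T y, y⟫_ℝ := by
    intro y
    obtain ⟨x', hx, hy⟩ := (LinearPMap.mem_graph_iff A).1 ((hTA _ y).2 rfl)
    simp only at hx hy
    have h1 := hpos x'
    rwa [hx, hy, real_inner_comm] at h1
  have hT0 : ∀ y, T y = 0 → y = 0 := by
    intro y hy
    exact LinearPMap.graph_fst_eq_zero_snd A ((hTA _ y).2 rfl) hy
  obtain ⟨S, hS, hSp, hSS, hSC⟩ := exists_sqrt_bounded hT hc hTpos
  have hSST : ∀ y, S (S y) = T y := fun y => by rw [← hSS]; rfl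
  have hS0 : ∀ y, S y = 0 → y = 0 := fun y hy => hT0 y (by rw [← hSST, hy, map_zero])
  have hSsym : ∀ x y, ⟪S x, y⟫_ℝ = ⟪x, S y⟫_ℝ := hS.isSymmetric
  let g : Submodule ℝ (H × H) :=
    LinearMap.range (LinearMap.prod (S : H →ₗ[ℝ] H) LinearMap.id)
  have hg : ∀ x y, (x, y) ∈ g ↔ x = S y := by
    intro x y
    constructor
    · rintro ⟨z, hz⟩
      have h1 : S z = x := congrArg Prod.fst hz
      have h2 : z = y := congrArg Prod.snd hz
      rw [← h1, h2]
    · rintro rfl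
      exact ⟨y, rfl⟩
  have hgr : g.toLinearPMap.graph = g := by
    refine Submodule.toLinearPMap_graph_eq g ?_
    rintro ⟨x, y⟩ hx h0
    have h1 := (hg x y).1 hx
    simp only at h0 ⊢
    exact hS0 y (by rw [← h1, h0])
  have hR : ∀ x y, (x, y) ∈ g.toLinearPMap.graph ↔ x = S y := by
    intro x y; rw [hgr]; exact hg x y
  refine ⟨g.toLinearPMap, ⟨isSelfAdjoint_of_graph ?_ ?_ ?_, ?_, ?_⟩, ?_⟩
  · rw [Submodule.dense_iff_topologicalClosure_eq_top, Submodule.topologicalClosure_eq_top_iff,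
      Submodule.eq_bot_iff]
    intro z hz
    rw [Submodule.mem_orthogonal] at hz
    refine hS0 z ?_
    have h1 : S (S z) ∈ g.toLinearPMap.domain :=
      LinearPMap.mem_domain_of_mem_graph ((hR _ (S z)).2 rfl)
    have h2 := hz _ h1
    rw [hSsym] at h2
    exact inner_self_eq_zero.1 h2
  · intro x r y s hx hy
    rw [(hR x r).1 hx, (hR y s).1 hy, hSsym]
  · intro y z h
    refine (hR y z).2 (ext_inner_right ℝ fun a => ?_)
    rw [hSsym]
    exact (h (S a) a ((hR _ a).2 rfl)).symm
  · intro x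
    have h1 := (hR _ _).1 (g.toLinearPMap.mem_graph x)
    rw [h1, real_inner_comm]
    exact hSp _
  · intro x y
    rw [hTA, ← hSST]
    constructor
    · rintro rfl
      exact ⟨S y, (hR _ _).2 rfl, (hR _ _).2 rfl⟩
    · rintro ⟨z, h1, h2⟩
      rw [(hR _ _).1 h1, (hR _ _).1 h2]
  · rintro R' ⟨hR', hR'p, hR'A⟩
    have hi : ∀ x, (x, (0 : H)) ∈ R'.graph → x = 0 := fun x hx =>
      hinj x ((hR'A x 0).2 ⟨0, hx, R'.graph.zero_mem⟩)
    have hs : ∀ y, ∃ x, (x, y) ∈ R'.graph := fun y => by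
      obtain ⟨z, _, hz⟩ := (hR'A _ y).1 ((hTA _ y).2 rfl)
      exact ⟨z, hz⟩
    obtain ⟨S', hS', hS'R⟩ := exists_inverse hR' hi hs
    have hS'S' : S' * S' = T := by
      ext y
      obtain ⟨z, h1, h2⟩ := (hR'A _ y).1 ((hTA _ y).2 rfl)
      rw [(hS'R _ _).1 h1, (hS'R _ _).1 h2]
      rfl
    have hcomm : Commute S' S := hSC S' (by
      rw [← hS'S']; exact (Commute.refl S').mul_right (Commute.refl S'))
    have hS'p : ∀ y, 0 ≤ ⟪S' y, y⟫_ℝ := by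
      intro y
      obtain ⟨x', hx, hy⟩ := (LinearPMap.mem_graph_iff R').1 ((hS'R _ y).2 rfl)
      simp only at hx hy
      have h1 := hR'p x'
      rwa [hx, hy, real_inner_comm] at h1
    have hSeq : ∀ x, S x = S' x := by
      intro x
      have h1 : (S + S') ((S - S') x) = 0 := by
        have h2 : (S + S') * (S - S') = 0 := by
          rw [← hcomm.symm.mul_self_sub_mul_self_eq, hSS, hS'S', sub_self]
        exact congrArg (fun B : H →L[ℝ] H => B x) h2
      set y := (S - S') x with hy
      have h3 : ⟪S y, y⟫_ℝ + ⟪S' y, y⟫_ℝ = 0 := by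
        rw [← inner_add_left]
        have h4 : S y + S' y = 0 := h1
        rw [h4, inner_zero_left]
      have h5 : ⟪S' y, y⟫_ℝ = 0 := by linarith [hSp y, hS'p y]
      have h6 : ⟪S y, y⟫_ℝ = 0 := by linarith [hSp y, hS'p y]
      have h7 : S y = - S' y := eq_neg_of_add_eq_zero_left h1
      have h8 : y = 0 := by
        refine hS0 y ?_
        set z := S y with hz
        set K := ⟪S z, z⟫_ℝ with hK
        have hK0 : 0 ≤ K := hSp z
        have h9 := hSp ((K + 1) • y - ‖z‖ ^ 2 • z)
        have h10 : ⟪S z, y⟫_ℝ = ‖z‖ ^ 2 := by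
          rw [hSsym, ← hz, real_inner_self_eq_norm_sq]
        simp only [map_sub, map_smul, inner_sub_left, inner_sub_right, inner_smul_left,
          inner_smul_right, ← hz, h6, h10, ← hK, real_inner_self_eq_norm_sq,
          RCLike.conj_to_real] at h9
        have h11 : ‖z‖ ^ 2 * ‖z‖ ^ 2 = 0 := by
          nlinarith [mul_nonneg hK0 (mul_self_nonneg (‖z‖ ^ 2)), mul_self_nonneg (‖z‖ ^ 2)]
        simpa using h11
      rw [hy] at h8
      exact sub_eq_zero.1 h8
    refine LinearPMap.eq_of_eq_graph ?_
    ext ⟨x, y⟩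
    rw [hS'R, hR, hSeq]

open Classical in
/-- The operator `A^{1/2}`: the unique positive square root of `A` (it exists and is unique for
every strictly positive self-adjoint `A`, by `existsUnique_posSqrt`; the value `0` is used when
there is none). -/
def posSqrt [CompleteSpace H] (A : H →ₗ.[ℝ] H) : H →ₗ.[ℝ] H :=
  if h : ∃ R : H →ₗ.[ℝ] H, IsPosSqrt R A then h.choose else 0

theorem isPosSqrt_posSqrt [CompleteSpace H] {A : H →ₗ.[ℝ] H} (hA : IsSelfAdjoint A)
    (hpos : ∃ c > 0, ∀ x : A.domain, c * ‖(x : H)‖ ^ 2 ≤ ⟪A x, (x : H)⟫_ℝ) :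
    IsPosSqrt (posSqrt A) A := by
  have h := (existsUnique_posSqrt hA hpos).exists
  rw [posSqrt, dif_pos h]
  exact h.choose_spec

/-! ### The spectrum and the stability threshold -/

/-- `z` is in the resolvent set of `A`: `A - z` maps `D(A)` bijectively onto `H`, with a bounded
inverse `B`. -/
def InResolventSet (A : H →ₗ.[ℝ] H) (z : ℝ) : Prop :=
  ∃ B : H →L[ℝ] H, (∀ y : H, ∃ h : B y ∈ A.domain, A ⟨B y, h⟩ - z • B y = y) ∧
    ∀ x : A.domain, B (A x - z • (x : H)) = x

/-- The spectrum of the (possibly unbounded) operator `A`. For a self-adjoint operator on a real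
Hilbert space this is the whole spectrum, since the spectrum of the complexification is real. -/
def spectrumSet (A : H →ₗ.[ℝ] H) : Set ℝ := {z | ¬ InResolventSet A z}

/-- The stability threshold `𝔱(κ)`, in terms of `α`, `κ` and `λ₁`. -/
def threshold (α lam₁ κ : ℝ) : ℝ :=
  if κ < α / lam₁ then
    2 * κ / α ^ 2 * (1 - α / (κ * lam₁) + α ^ 2 / (κ ^ 2 * lam₁ ^ 2))
  else 2 * κ / α ^ 2

/-! ### The abstract MGT–Fourier system -/

/-- The phase space `H¹ × H¹ × H × H`, where `H¹ = D(A^{1/2})`. -/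
structure PhaseSpace [CompleteSpace H] (A : H →ₗ.[ℝ] H) where
  /-- the position -/
  u : (posSqrt A).domain
  /-- the velocity `u_t` -/
  v : (posSqrt A).domain
  /-- the acceleration `u_tt` -/
  w : H
  /-- the temperature -/
  θ : H

/-- The energy `½ (‖v + α u‖₁² + ‖w + α v‖² + ‖v‖₁² + ‖θ‖²)`, where `‖x‖₁ = ‖A^{1/2} x‖`. -/
def energy [CompleteSpace H] (A : H →ₗ.[ℝ] H) (α : ℝ) (U : PhaseSpace A) : ℝ :=
  (1 / 2) * (‖posSqrt A (U.v + α • U.u)‖ ^ 2 + ‖U.w + α • (U.v : H)‖ ^ 2 +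
    ‖posSqrt A U.v‖ ^ 2 + ‖U.θ‖ ^ 2)

/-- `U = (u, v, w, θ)`, restricted to `[0, ∞)`, is a weak solution, continuous with values in the
phase space, of
`u_ttt + α u_tt + β A u_t + γ A u = η A θ`, `θ_t + κ A θ = - η A u_tt - α η A u_t`.
The two equations are tested against the elements `φ` of `D(A)`, the operator `A` being moved
onto `φ`. The values of `U` at negative times are irrelevant. -/
structure IsWeakSolution [CompleteSpace H] (A : H →ₗ.[ℝ] H) (α β γ κ η : ℝ)
    (U : ℝ → PhaseSpace A) : Prop where
  continuousOn_u : ContinuousOn (fun t => posSqrt A (U t).u) (Ici 0)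
  continuousOn_v : ContinuousOn (fun t => posSqrt A (U t).v) (Ici 0)
  continuousOn_w : ContinuousOn (fun t => (U t).w) (Ici 0)
  continuousOn_θ : ContinuousOn (fun t => (U t).θ) (Ici 0)
  deriv_u : ∀ t, 0 ≤ t →
    HasDerivWithinAt (fun s => ((U s).u : H)) ((U t).v : H) (Ici 0) t
  deriv_v : ∀ t, 0 ≤ t →
    HasDerivWithinAt (fun s => ((U s).v : H)) (U t).w (Ici 0) t
  deriv_w : ∀ φ : A.domain, ∀ t, 0 ≤ t →
    HasDerivWithinAt (fun s => ⟪(U s).w, (φ : H)⟫_ℝ)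
      (η * ⟪(U t).θ, A φ⟫_ℝ - α * ⟪(U t).w, (φ : H)⟫_ℝ - β * ⟪((U t).v : H), A φ⟫_ℝ
        - γ * ⟪((U t).u : H), A φ⟫_ℝ) (Ici 0) t
  deriv_θ : ∀ φ : A.domain, ∀ t, 0 ≤ t →
    HasDerivWithinAt (fun s => ⟪(U s).θ, (φ : H)⟫_ℝ)
      (-(κ * ⟪(U t).θ, A φ⟫_ℝ) - η * ⟪(U t).w, A φ⟫_ℝ - α * η * ⟪((U t).v : H), A φ⟫_ℝ)
      (Ici 0) t

/-- `S` is the solution semigroup of the system: for every initial datum `U₀` the map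
`t ↦ S t U₀` is the unique weak solution on `[0, ∞)` that starts from `U₀`. -/
structure IsSolutionSemigroup [CompleteSpace H] (A : H →ₗ.[ℝ] H) (α β γ κ η : ℝ)
    (S : ℝ → PhaseSpace A → PhaseSpace A) : Prop where
  initial : ∀ U₀, S 0 U₀ = U₀
  isWeakSolution : ∀ U₀, IsWeakSolution A α β γ κ η (fun t => S t U₀)
  unique : ∀ U : ℝ → PhaseSpace A, IsWeakSolution A α β γ κ η U →
    ∀ t, 0 ≤ t → U t = S t (U 0)

/-- The system has a solution semigroup and its energy decays exponentially, uniformly with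
respect to the initial data. -/
def ExponentiallyStable [CompleteSpace H] (A : H →ₗ.[ℝ] H) (α β γ κ η : ℝ) : Prop :=
  ∃ S : ℝ → PhaseSpace A → PhaseSpace A, IsSolutionSemigroup A α β γ κ η S ∧
    ∃ M ω : ℝ, 1 ≤ M ∧ 0 < ω ∧ ∀ U₀ : PhaseSpace A, ∀ t, 0 ≤ t →
      energy A α (S t U₀) ≤ M * energy A α U₀ * Real.exp (-ω * t)

end MGTFourier

end

/-!
In the coordinates `(p, b, ζ, θ) = (A^{1/2}(v + α u), A^{1/2} v, w + α v, θ)` the energy is half the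
sum of the squared norms. The obvious energy balance contains `μ ‖b‖²` with the wrong sign; adding
`μ/α ‖η⁻¹ A^{-1/2} θ + b‖²`, in whose derivative the unbounded term `A^{1/2} ζ` cancels, restores
the sign at the price of `μ η⁻² (‖A^{-1/2} θ‖² + κ² α⁻² ‖A^{1/2} θ‖²)`. The dissipation
`κ ‖A^{1/2} θ‖²` pays for this as soon as `μ (λ₁⁻² + κ² α⁻²) < κ η²`, which follows from
`𝔱(κ) μ < η²`. Three further multipliers then recover the dissipation of `ζ`, `p` and `b`.

All constants depend on `A` only through a bound for `S = A^{-1/2}`. The estimate therefore holds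
uniformly for the systems in which the bounded operator `(S + ε)⁻¹` replaces `A^{1/2}`, and their
solutions converge as `ε → 0`. Uniqueness follows as well: `A⁻¹` maps the difference of two weak
solutions with the same initial datum to a strong solution that starts at `0`, so it vanishes.
-/

namespace MGTFourier

open scoped InnerProductSpace Topology
open Set Filter

variable {H : Type*} [NormedAddCommGroup H] [InnerProductSpace ℝ H]

/-! ### Strong solutions -/

/-- The state space in the coordinates `(p, b, ζ, θ) = (A^{1/2}(v + α u), A^{1/2} v, w + α v, θ)`,
in which the energy is half the sum of the squared norms. -/
abbrev State (H : Type*) := H × H × H × H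

/-- The sum of the squared norms of the coordinates (the norm of `State H` is the sup norm). -/
noncomputable def sqNorm (y : State H) : ℝ :=
  ‖y.1‖ ^ 2 + ‖y.2.1‖ ^ 2 + ‖y.2.2.1‖ ^ 2 + ‖y.2.2.2‖ ^ 2

/-- The curve `y` passes at time `t` through the point `(S q, S r, S² g, S² h)` of the domain of
the generator, with the velocity that the system prescribes there; `S` stands for `A^{-1/2}`, so
that `A^{1/2}` and `A` only occur through the preimages `q`, `r`, `g`, `h`. -/
structure FlowsAt (S : H →L[ℝ] H) (α γ μ κ η : ℝ) (y : ℝ → State H) (I : Set ℝ) (t : ℝ)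
    (q r g h : H) : Prop where
  value : y t = (S q, S r, S (S g), S (S h))
  deriv : HasDerivWithinAt y (S g, S g - α • S r, η • h - (γ / α) • q + (μ / α) • r,
    -(κ • h) - η • g) I t

theorem hasDerivWithinAt_fst {E F : Type*} [NormedAddCommGroup E] [NormedSpace ℝ E]
    [NormedAddCommGroup F] [NormedSpace ℝ F] {f : ℝ → E × F} {f' : E × F} {I : Set ℝ} {t : ℝ}
    (hf : HasDerivWithinAt f f' I t) : HasDerivWithinAt (fun τ => (f τ).1) f'.1 I t :=
  (ContinuousLinearMap.fst ℝ E F).hasFDerivAt.comp_hasDerivWithinAt t hf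

theorem hasDerivWithinAt_snd {E F : Type*} [NormedAddCommGroup E] [NormedSpace ℝ E]
    [NormedAddCommGroup F] [NormedSpace ℝ F] {f : ℝ → E × F} {f' : E × F} {I : Set ℝ} {t : ℝ}
    (hf : HasDerivWithinAt f f' I t) : HasDerivWithinAt (fun τ => (f τ).2) f'.2 I t :=
  (ContinuousLinearMap.snd ℝ E F).hasFDerivAt.comp_hasDerivWithinAt t hf

namespace FlowsAt

variable {S : H →L[ℝ] H} {α γ μ κ η : ℝ} {y : ℝ → State H} {I : Set ℝ} {t : ℝ} {q r g h : H}

theorem deriv_p (hy : FlowsAt S α γ μ κ η y I t q r g h) :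
    HasDerivWithinAt (fun τ => (y τ).1) (S g) I t :=
  hasDerivWithinAt_fst hy.deriv

theorem deriv_b (hy : FlowsAt S α γ μ κ η y I t q r g h) :
    HasDerivWithinAt (fun τ => (y τ).2.1) (S g - α • S r) I t :=
  hasDerivWithinAt_fst (hasDerivWithinAt_snd hy.deriv)

theorem deriv_ζ (hy : FlowsAt S α γ μ κ η y I t q r g h) :
    HasDerivWithinAt (fun τ => (y τ).2.2.1) (η • h - (γ / α) • q + (μ / α) • r) I t :=
  hasDerivWithinAt_fst (hasDerivWithinAt_snd (hasDerivWithinAt_snd hy.deriv))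

theorem deriv_θ (hy : FlowsAt S α γ μ κ η y I t q r g h) :
    HasDerivWithinAt (fun τ => (y τ).2.2.2) (-(κ • h) - η • g) I t :=
  hasDerivWithinAt_snd (hasDerivWithinAt_snd (hasDerivWithinAt_snd hy.deriv))

end FlowsAt

/-! ### The Lyapunov functional -/

/-- The part of the Lyapunov functional whose derivative controls `‖A^{1/2} θ‖²` and `μ ‖b‖²`. -/
noncomputable def coreFunctional (S : H →L[ℝ] H) (α γ μ η : ℝ) (y : State H) : ℝ :=
  1 / 2 * (‖y.2.2.1‖ ^ 2 + ‖y.2.2.2‖ ^ 2 + γ / α * ‖y.1‖ ^ 2 - μ / α * ‖y.2.1‖ ^ 2) +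
    μ / α * ‖η⁻¹ • S y.2.2.2 + y.2.1‖ ^ 2

/-- The multiplier that recovers the dissipation of `ζ` from that of `θ`. -/
noncomputable def couplingFunctional (S : H →L[ℝ] H) (η : ℝ) (y : State H) : ℝ :=
  η⁻¹ * ⟪S (S y.2.2.2), y.2.2.1⟫_ℝ

/-- The multiplier that recovers the dissipation of `p` from that of `ζ`. -/
noncomputable def equipartitionFunctional (S : H →L[ℝ] H) (y : State H) : ℝ :=
  ⟪S y.1, y.2.2.1⟫_ℝ

/-- The multiplier that recovers the dissipation of `b` from that of `p`; note that
`p - b = α A^{1/2} u`. -/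
noncomputable def displacementFunctional (y : State H) : ℝ :=
  1 / 2 * ‖y.1 - y.2.1‖ ^ 2

namespace FlowsAt

variable {S : H →L[ℝ] H} {α γ μ κ η : ℝ} {y : ℝ → State H} {I : Set ℝ} {t : ℝ} {q r g h : H}

theorem hasDerivWithinAt_coreFunctional (hα : α ≠ 0) (hη : η ≠ 0)
    (hS : (S : H →ₗ[ℝ] H).IsSymmetric) (hy : FlowsAt S α γ μ κ η y I t q r g h) :
    HasDerivWithinAt (fun τ => coreFunctional S α γ μ η (y τ))
      (-(κ * ‖S h‖ ^ 2) + μ / η ^ 2 * (‖S (S (S h))‖ ^ 2 + κ ^ 2 / α ^ 2 * ‖S h‖ ^ 2)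
        - μ * ‖S r + (η⁻¹ • S (S (S h)) + (κ / (α * η)) • S h)‖ ^ 2) I t := by
  have hSym (x z : H) : ⟪S x, z⟫_ℝ = ⟪x, S z⟫_ℝ := hS x z
  have hn := (S.hasFDerivAt.comp_hasDerivWithinAt t hy.deriv_θ).const_smul η⁻¹
  have hd := ((((hy.deriv_ζ.norm_sq.add hy.deriv_θ.norm_sq).add
    (hy.deriv_p.norm_sq.const_mul (γ / α))).sub (hy.deriv_b.norm_sq.const_mul (μ / α))).const_mul
      (1 / 2)).add ((hn.add hy.deriv_b).norm_sq.const_mul (μ / α))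
  refine hd.congr_deriv ?_
  have hn' : η⁻¹ • S (-(κ • h) - η • g) + (S g - α • S r) = -((κ / η) • S h + α • S r) := by
    rw [map_sub, map_neg, map_smul, map_smul, smul_sub, smul_smul, smul_neg, smul_smul,
      inv_mul_cancel₀ hη, one_smul, div_eq_inv_mul]
    abel
  have hζ : ⟪S (S g), η • h - (γ / α) • q + (μ / α) • r⟫_ℝ
      = η * ⟪S g, S h⟫_ℝ - γ / α * ⟪S q, S g⟫_ℝ + μ / α * ⟪S r, S g⟫_ℝ := by
    rw [hSym, map_add, map_sub, map_smul, map_smul, map_smul]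
    simp only [inner_add_right, inner_sub_right, inner_smul_right, real_inner_comm (S g)]
  have hθ : ⟪S (S h), -(κ • h) - η • g⟫_ℝ = -(κ * ‖S h‖ ^ 2) - η * ⟪S g, S h⟫_ℝ := by
    rw [hSym, map_sub, map_neg, map_smul, map_smul]
    simp only [inner_sub_right, inner_smul_right, inner_neg_right, real_inner_self_eq_norm_sq,
      real_inner_comm (S h) (S g)]
  simp only [Pi.add_apply, Pi.smul_apply, Function.comp_apply, hy.value, hn', hζ, hθ]
  simp only [← real_inner_self_eq_norm_sq, inner_add_left, inner_add_right, inner_sub_right,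
    inner_smul_left, inner_smul_right, inner_neg_right, RCLike.conj_to_real]
  rw [real_inner_comm (S r) (S (S (S h))), real_inner_comm (S h) (S (S (S h))),
    real_inner_comm (S r) (S h)]
  field_simp
  ring

theorem hasDerivWithinAt_couplingFunctional (hη : η ≠ 0) (hS : (S : H →ₗ[ℝ] H).IsSymmetric)
    (hy : FlowsAt S α γ μ κ η y I t q r g h) :
    HasDerivWithinAt (fun τ => couplingFunctional S η (y τ))
      (‖S (S h)‖ ^ 2 - γ / (α * η) * ⟪S (S (S h)), (y t).1⟫_ℝ
        + μ / (α * η) * ⟪S (S (S h)), S r⟫_ℝ - κ / η * ⟪S (S h), (y t).2.2.1⟫_ℝ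
        - ‖(y t).2.2.1‖ ^ 2) I t := by
  have hSym (x z : H) : ⟪S x, z⟫_ℝ = ⟪x, S z⟫_ℝ := hS x z
  have hSθ := S.hasFDerivAt.comp_hasDerivWithinAt t
    (S.hasFDerivAt.comp_hasDerivWithinAt t hy.deriv_θ)
  refine ((hSθ.inner ℝ hy.deriv_ζ).const_mul η⁻¹).congr_deriv ?_
  have hk : ⟪S (S (S h)), S h⟫_ℝ = ‖S (S h)‖ ^ 2 := by
    rw [hSym, real_inner_self_eq_norm_sq]
  simp only [Function.comp_apply, hy.value, map_add, map_sub, map_neg, map_smul, inner_add_right,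
    inner_sub_right, inner_sub_left, inner_neg_left, inner_smul_left, inner_smul_right,
    RCLike.conj_to_real, hSym (S (S (S h))), hk, real_inner_self_eq_norm_sq]
  field_simp
  ring

theorem hasDerivWithinAt_equipartitionFunctional (hS : (S : H →ₗ[ℝ] H).IsSymmetric)
    (hy : FlowsAt S α γ μ κ η y I t q r g h) :
    HasDerivWithinAt (fun τ => equipartitionFunctional S (y τ))
      (‖(y t).2.2.1‖ ^ 2 + η * ⟪S h, (y t).1⟫_ℝ - γ / α * ‖(y t).1‖ ^ 2
        + μ / α * ⟪(y t).1, S r⟫_ℝ) I t := by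
  have hSym (x z : H) : ⟪S x, z⟫_ℝ = ⟪x, S z⟫_ℝ := hS x z
  refine ((S.hasFDerivAt.comp_hasDerivWithinAt t hy.deriv_p).inner ℝ hy.deriv_ζ).congr_deriv ?_
  simp only [Function.comp_apply, hy.value, hSym (S q), map_add, map_sub, map_smul,
    inner_add_right, inner_sub_right, inner_smul_right, real_inner_self_eq_norm_sq,
    real_inner_comm (S q)]
  ring

theorem hasDerivWithinAt_displacementFunctional (hy : FlowsAt S α γ μ κ η y I t q r g h) :
    HasDerivWithinAt (fun τ => displacementFunctional (y τ))
      (α * ⟪(y t).1, (y t).2.1⟫_ℝ - α * ‖(y t).2.1‖ ^ 2) I t := by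
  refine ((hy.deriv_p.sub hy.deriv_b).norm_sq.const_mul (1 / 2)).congr_deriv ?_
  simp only [hy.value, sub_sub_cancel, inner_smul_right, inner_sub_left,
    real_inner_self_eq_norm_sq, Pi.sub_apply]
  ring

end FlowsAt

section Estimates

variable {α γ μ κ η s : ℝ}

theorem smul_inner_le_add (d : ℝ) {e : ℝ} (he : 0 < e) (x y : H) :
    d * ⟪x, y⟫_ℝ ≤ e * ‖y‖ ^ 2 + d ^ 2 / (4 * e) * ‖x‖ ^ 2 := by
  have h : e * ‖y‖ ^ 2 + d ^ 2 / (4 * e) * ‖x‖ ^ 2 - d * ⟪x, y⟫_ℝ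
      = ‖(2 * e) • y - d • x‖ ^ 2 / (4 * e) := by
    rw [norm_sub_sq_real, norm_smul, norm_smul, mul_pow, mul_pow, Real.norm_eq_abs,
      Real.norm_eq_abs, sq_abs, sq_abs, inner_smul_left, inner_smul_right, real_inner_comm,
      RCLike.conj_to_real]
    field_simp
    ring
  exact sub_nonneg.1 (h ▸ by positivity)

theorem norm_sq_le_two_mul_add (x y : H) : ‖x‖ ^ 2 ≤ 2 * ‖x + y‖ ^ 2 + 2 * ‖y‖ ^ 2 := by
  have h := parallelogram_law_with_norm ℝ (x + y) y
  rw [add_sub_cancel_right] at h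
  nlinarith [sq_nonneg ‖x + y + y‖]

theorem norm_sq_apply_le {S : H →L[ℝ] H} (hS : ‖S‖ ≤ s) (x : H) :
    ‖S x‖ ^ 2 ≤ s ^ 2 * ‖x‖ ^ 2 := by
  rw [← mul_pow]
  exact pow_le_pow_left₀ (norm_nonneg _) (S.le_of_opNorm_le hS x) 2

theorem norm_sq_apply_apply_le {S : H →L[ℝ] H} (hS : ‖S‖ ≤ s) (x : H) :
    ‖S (S x)‖ ^ 2 ≤ s ^ 4 * ‖x‖ ^ 2 := by
  nlinarith [norm_sq_apply_le hS (S x),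
    mul_le_mul_of_nonneg_left (norm_sq_apply_le hS x) (sq_nonneg s)]

theorem exists_norm_sq_add_le (c d : ℝ) (s : ℝ) : ∃ m, 0 ≤ m ∧ ∀ S : H →L[ℝ] H, ‖S‖ ≤ s →
    ∀ k : H, ‖c • S (S k) + d • k‖ ^ 2 ≤ m * ‖k‖ ^ 2 := by
  refine ⟨2 * c ^ 2 * s ^ 4 + 2 * d ^ 2, by positivity, fun S hS k => ?_⟩
  have h := norm_sq_le_two_mul_add (c • S (S k) + d • k) (-(d • k))
  rw [add_neg_cancel_right, norm_neg, norm_smul, norm_smul, mul_pow, mul_pow, Real.norm_eq_abs,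
    Real.norm_eq_abs, sq_abs, sq_abs] at h
  nlinarith [mul_le_mul_of_nonneg_left (norm_sq_apply_apply_le hS k) (sq_nonneg c)]

theorem ne_zero_of_lt_mul_sq {a b x : ℝ} (ha : 0 ≤ a) (h : a < b * x ^ 2) : x ≠ 0 := by
  rintro rfl
  exact h.not_ge (by rwa [zero_pow two_ne_zero, mul_zero])

theorem exists_core_dissipation (hμ : 0 ≤ μ)
    (hcond : μ * (s ^ 4 + κ ^ 2 / α ^ 2) < κ * η ^ 2) :
    ∃ c > 0, ∀ S : H →L[ℝ] H, ‖S‖ ≤ s → ∀ k b : H,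
      -(κ * ‖k‖ ^ 2) + μ / η ^ 2 * (‖S (S k)‖ ^ 2 + κ ^ 2 / α ^ 2 * ‖k‖ ^ 2)
        - μ * ‖b + (η⁻¹ • S (S k) + (κ / (α * η)) • k)‖ ^ 2
      ≤ -(c * (‖k‖ ^ 2 + μ * ‖b‖ ^ 2)) := by
  have hη : η ≠ 0 := ne_zero_of_lt_mul_sq (by positivity) hcond
  obtain ⟨ε, hε, hκε⟩ : ∃ ε > 0, μ / η ^ 2 * (s ^ 4 + κ ^ 2 / α ^ 2) = κ - ε := by
    refine ⟨κ - μ / η ^ 2 * (s ^ 4 + κ ^ 2 / α ^ 2), ?_, (sub_sub_cancel _ _).symm⟩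
    rw [gt_iff_lt, sub_pos, div_mul_eq_mul_div, div_lt_iff₀ (by positivity)]
    exact hcond
  obtain ⟨m, hm, hbound⟩ := exists_norm_sq_add_le (H := H) η⁻¹ (κ / (α * η)) s
  have hden : 0 < 1 + 2 * μ * m := by positivity
  obtain ⟨c, hc, hc_half, hcε⟩ : ∃ c > 0, c ≤ 1 / 2 ∧ c * (1 + 2 * μ * m) ≤ ε :=
    ⟨min (1 / 2) (ε / (1 + 2 * μ * m)), by positivity, min_le_left _ _,
      (le_div_iff₀ hden).1 (min_le_right _ _)⟩
  refine ⟨c, hc, fun S hS k b => ?_⟩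
  have hn := hbound S hS k
  set n := η⁻¹ • S (S k) + (κ / (α * η)) • k
  have hgain : μ / η ^ 2 * (‖S (S k)‖ ^ 2 + κ ^ 2 / α ^ 2 * ‖k‖ ^ 2) ≤ (κ - ε) * ‖k‖ ^ 2 := by
    rw [← hκε, mul_assoc, add_mul]
    gcongr
    exact norm_sq_apply_apply_le hS k
  have hb : c * (μ * ‖b‖ ^ 2) ≤ c * (μ * (2 * ‖b + n‖ ^ 2 + 2 * (m * ‖k‖ ^ 2))) := by
    gcongr
    linarith [norm_sq_le_two_mul_add b n]
  linarith [mul_le_mul_of_nonneg_right hc_half (by positivity : 0 ≤ μ * ‖b + n‖ ^ 2),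
    mul_le_mul_of_nonneg_right hcε (sq_nonneg ‖k‖)]

theorem exists_coupling_dissipation (hμ : 0 ≤ μ) {e : ℝ} (he : 0 < e) :
    ∃ C, 0 ≤ C ∧ ∀ S : H →L[ℝ] H, ‖S‖ ≤ s → ∀ k p b ζ : H,
      ‖S k‖ ^ 2 - γ / (α * η) * ⟪S (S k), p⟫_ℝ + μ / (α * η) * ⟪S (S k), b⟫_ℝ
        - κ / η * ⟪S k, ζ⟫_ℝ - ‖ζ‖ ^ 2
      ≤ -(1 / 2 * ‖ζ‖ ^ 2) + e * ‖p‖ ^ 2 + C * (‖k‖ ^ 2 + μ * ‖b‖ ^ 2) := by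
  set c₁ := 1 + (-(κ / η)) ^ 2 / (4 * (1 / 2))
  set c₂ := (-(γ / (α * η))) ^ 2 / (4 * e) + μ * ((1 / (α * η)) ^ 2 / (4 * 1))
  have hc₂ : 0 ≤ c₂ := by positivity
  refine ⟨c₁ * s ^ 2 + c₂ * s ^ 4 + 1, by positivity, fun S hS k p b ζ => ?_⟩
  have hζ := smul_inner_le_add (-(κ / η)) one_half_pos (S k) ζ
  have hp := smul_inner_le_add (-(γ / (α * η))) he (S (S k)) p
  have hb := mul_le_mul_of_nonneg_left (smul_inner_le_add (1 / (α * η)) one_pos (S (S k)) b) hμ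
  have hk := mul_le_mul_of_nonneg_left (norm_sq_apply_le hS k) (by positivity : 0 ≤ c₁)
  have hSk := mul_le_mul_of_nonneg_left (norm_sq_apply_apply_le hS k) hc₂
  have hrest : 0 ≤ ‖k‖ ^ 2 + (c₁ * s ^ 2 + c₂ * s ^ 4) * (μ * ‖b‖ ^ 2) := by positivity
  linear_combination hζ + hp + hb + hk + hSk + hrest

theorem exists_equipartition_dissipation (hα : 0 < α) (hγ : 0 < γ) (hμ : 0 ≤ μ) :
    ∃ C, 0 ≤ C ∧ ∀ k p b ζ : H,
      ‖ζ‖ ^ 2 + η * ⟪k, p⟫_ℝ - γ / α * ‖p‖ ^ 2 + μ / α * ⟪p, b⟫_ℝ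
      ≤ ‖ζ‖ ^ 2 - γ / (2 * α) * ‖p‖ ^ 2 + C * (‖k‖ ^ 2 + μ * ‖b‖ ^ 2) := by
  have he : 0 < γ / (4 * α) := by positivity
  set c₁ := η ^ 2 / (4 * (γ / (4 * α)))
  set c₂ := μ / α ^ 2 / (4 * (γ / (4 * α))) with hc₂
  refine ⟨c₁ + c₂, by positivity, fun k p b ζ => ?_⟩
  have hk := smul_inner_le_add η he k p
  have hb := smul_inner_le_add (μ / α) he b p
  have hbμ : (μ / α) ^ 2 / (4 * (γ / (4 * α))) * ‖b‖ ^ 2 = c₂ * (μ * ‖b‖ ^ 2) := by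
    rw [hc₂]; ring
  have hp : γ / (4 * α) * ‖p‖ ^ 2 = γ / α * ‖p‖ ^ 2 / 4 := by ring
  have hp' : γ / (2 * α) * ‖p‖ ^ 2 = γ / α * ‖p‖ ^ 2 / 2 := by ring
  have hrest : 0 ≤ c₁ * (μ * ‖b‖ ^ 2) + c₂ * ‖k‖ ^ 2 := by positivity
  rw [real_inner_comm] at hb
  linarith

theorem displacement_dissipation (hα : 0 < α) (p b : H) :
    α * ⟪p, b⟫_ℝ - α * ‖b‖ ^ 2 ≤ α / 2 * ‖p‖ ^ 2 - α / 2 * ‖b‖ ^ 2 := by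
  have h := norm_sub_sq_real p b
  nlinarith [mul_nonneg hα.le (sq_nonneg ‖p - b‖)]

end Estimates

section Lyapunov

variable {α γ μ κ η s : ℝ}

theorem exists_le_coreFunctional (hα : 0 < α) (hγ : 0 < γ) (hμ : 0 ≤ μ)
    (hs : 2 * μ * s ^ 2 < α * η ^ 2) :
    ∃ c > 0, ∀ S : H →L[ℝ] H, ‖S‖ ≤ s → ∀ y : State H,
      c * (‖y.1‖ ^ 2 + ‖y.2.2.1‖ ^ 2 + ‖y.2.2.2‖ ^ 2) ≤ coreFunctional S α γ μ η y := by
  have hη : η ≠ 0 := ne_zero_of_lt_mul_sq (by positivity) hs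
  set ε := 1 / 2 - μ / α * (η⁻¹ ^ 2 * s ^ 2) with hε
  have hε0 : 0 < ε := by
    have : ε = (α * η ^ 2 - 2 * μ * s ^ 2) / (2 * α * η ^ 2) := by rw [hε]; field_simp
    rw [this]
    exact div_pos (sub_pos.2 hs) (by positivity)
  obtain ⟨c, hc, hc_half, hcγ, hcε⟩ : ∃ c > 0, c ≤ 1 / 2 ∧ c ≤ γ / α / 2 ∧ c ≤ ε :=
    ⟨min (1 / 2) (min (γ / α / 2) ε), by positivity, min_le_left _ _,
      (min_le_right _ _).trans (min_le_left _ _), (min_le_right _ _).trans (min_le_right _ _)⟩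
  refine ⟨c, hc, fun S hS ⟨p, b, ζ, θ⟩ => ?_⟩
  have hb := norm_sq_le_two_mul_add b (η⁻¹ • S θ)
  have hn : ‖η⁻¹ • S θ‖ ^ 2 ≤ η⁻¹ ^ 2 * s ^ 2 * ‖θ‖ ^ 2 := by
    rw [norm_smul, mul_pow, Real.norm_eq_abs, sq_abs, mul_assoc]
    exact mul_le_mul_of_nonneg_left (norm_sq_apply_le hS θ) (by positivity)
  have hθ := mul_le_mul_of_nonneg_left (by linarith :
    1 / 2 * ‖b‖ ^ 2 - η⁻¹ ^ 2 * s ^ 2 * ‖θ‖ ^ 2 ≤ ‖b + η⁻¹ • S θ‖ ^ 2) (div_nonneg hμ hα.le)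
  rw [hε] at hcε
  simp only [coreFunctional, add_comm (η⁻¹ • S θ)]
  linarith [mul_le_mul_of_nonneg_right hc_half (sq_nonneg ‖ζ‖),
    mul_le_mul_of_nonneg_right hcγ (sq_nonneg ‖p‖), mul_le_mul_of_nonneg_right hcε (sq_nonneg ‖θ‖)]

theorem exists_coreFunctional_le (hα : 0 < α) (hγ : 0 < γ) (hμ : 0 ≤ μ) :
    ∃ C, 0 ≤ C ∧ ∀ S : H →L[ℝ] H, ‖S‖ ≤ s → ∀ y : State H,
      coreFunctional S α γ μ η y ≤ C * sqNorm y := by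
  set n := η⁻¹ ^ 2 * s ^ 2
  refine ⟨1 / 2 + γ / α / 2 + μ / α * (2 * n + 2), by positivity, fun S hS ⟨p, b, ζ, θ⟩ => ?_⟩
  have hb := norm_sq_le_two_mul_add (η⁻¹ • S θ + b) (-b)
  have hn : ‖η⁻¹ • S θ‖ ^ 2 ≤ n * ‖θ‖ ^ 2 := by
    rw [norm_smul, mul_pow, Real.norm_eq_abs, sq_abs, mul_assoc]
    exact mul_le_mul_of_nonneg_left (norm_sq_apply_le hS θ) (by positivity)
  rw [add_neg_cancel_right, norm_neg] at hb
  have hμb := mul_le_mul_of_nonneg_left (by linarith :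
    ‖η⁻¹ • S θ + b‖ ^ 2 ≤ 2 * (n * ‖θ‖ ^ 2) + 2 * ‖b‖ ^ 2) (div_nonneg hμ hα.le)
  have hrest : 0 ≤ 1 / 2 * (‖p‖ ^ 2 + ‖b‖ ^ 2 + μ / α * ‖b‖ ^ 2) +
      γ / α / 2 * (‖b‖ ^ 2 + ‖ζ‖ ^ 2 + ‖θ‖ ^ 2) +
      μ / α * ((2 * n + 2) * (‖p‖ ^ 2 + ‖ζ‖ ^ 2) + 2 * n * ‖b‖ ^ 2 + 2 * ‖θ‖ ^ 2) := by
    positivity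
  simp only [coreFunctional, sqNorm]
  linarith

theorem exists_abs_cross_le (η s : ℝ) :
    ∃ C, 0 ≤ C ∧ ∀ S : H →L[ℝ] H, ‖S‖ ≤ s → ∀ y : State H,
      |4 * couplingFunctional S η y + equipartitionFunctional S y|
        ≤ C * (‖y.1‖ ^ 2 + ‖y.2.2.1‖ ^ 2 + ‖y.2.2.2‖ ^ 2) := by
  set c := (4 * η⁻¹) ^ 2 / (4 * (1 / 2)) with hc
  refine ⟨1 + c * s ^ 4 + s ^ 2 / 2, by positivity, fun S hS ⟨p, b, ζ, θ⟩ => ?_⟩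
  have hF (d : ℝ) (hd : d ^ 2 = 1) :
      d * (4 * η⁻¹) * ⟪S (S θ), ζ⟫_ℝ ≤ 1 / 2 * ‖ζ‖ ^ 2 + c * (s ^ 4 * ‖θ‖ ^ 2) := by
    have h := smul_inner_le_add (d * (4 * η⁻¹)) one_half_pos (S (S θ)) ζ
    rw [mul_pow, hd, one_mul, ← hc] at h
    linarith [mul_le_mul_of_nonneg_left (norm_sq_apply_apply_le hS θ) (by positivity : 0 ≤ c)]
  have hG (d : ℝ) (hd : d ^ 2 = 1) :
      d * ⟪S p, ζ⟫_ℝ ≤ 1 / 2 * ‖ζ‖ ^ 2 + 1 / 2 * (s ^ 2 * ‖p‖ ^ 2) := by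
    have h := smul_inner_le_add d one_half_pos (S p) ζ
    rw [hd] at h
    linarith [norm_sq_apply_le hS p]
  have hrest : 0 ≤ (‖p‖ ^ 2 + ‖θ‖ ^ 2) + c * s ^ 4 * (‖p‖ ^ 2 + ‖ζ‖ ^ 2) +
    s ^ 2 / 2 * (‖ζ‖ ^ 2 + ‖θ‖ ^ 2) := by positivity
  simp only [couplingFunctional, equipartitionFunctional]
  rw [abs_le]
  constructor
  · linarith [hF (-1) (by norm_num), hG (-1) (by norm_num)]
  · linarith [hF 1 (by norm_num), hG 1 (by norm_num)]

/-- The Lyapunov functional; `N` is a large weight. -/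
noncomputable def lyapunov (N : ℝ) (S : H →L[ℝ] H) (α γ μ η : ℝ) (y : State H) : ℝ :=
  N * coreFunctional S α γ μ η y + (4 * couplingFunctional S η y + equipartitionFunctional S y)
    + γ / (4 * α ^ 2) * displacementFunctional y

theorem exists_le_lyapunov (hα : 0 < α) (hγ : 0 < γ) (hμ : 0 ≤ μ)
    (hs : 2 * μ * s ^ 2 < α * η ^ 2) :
    ∃ N₀ : ℝ, ∃ c > 0, ∀ N ≥ N₀, ∀ S : H →L[ℝ] H, ‖S‖ ≤ s → ∀ y : State H,
      c * sqNorm y ≤ lyapunov N S α γ μ η y := by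
  obtain ⟨c, hc, hcore⟩ := exists_le_coreFunctional (H := H) hα hγ hμ hs
  obtain ⟨C, hC, hcross⟩ := exists_abs_cross_le (H := H) η s
  set w := γ / (4 * α ^ 2)
  have : 0 < w := by positivity
  refine ⟨(C + 1) / c, min (1 / 3) (w / 4), by positivity, fun N hN S hS y => ?_⟩
  have hNc : C + 1 ≤ N * c := (div_le_iff₀ hc).1 hN
  set P := ‖y.1‖ ^ 2 + ‖y.2.2.1‖ ^ 2 + ‖y.2.2.2‖ ^ 2 with hP
  have hNcore : (C + 1) * P ≤ N * coreFunctional S α γ μ η y :=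
    calc (C + 1) * P ≤ N * c * P := by gcongr
      _ = N * (c * P) := mul_assoc _ _ _
      _ ≤ N * coreFunctional S α γ μ η y := by
        have : 0 ≤ N := le_trans (by positivity) hN
        gcongr
        exact hcore S hS y
  have hb := norm_sq_le_two_mul_add y.2.1 (-y.1)
  rw [← sub_eq_add_neg, norm_neg, norm_sub_rev] at hb
  have hsq : sqNorm y ≤ 3 * P + 2 * ‖y.1 - y.2.1‖ ^ 2 := by
    rw [sqNorm, hP]
    linarith [sq_nonneg ‖y.2.2.1‖, sq_nonneg ‖y.2.2.2‖]
  calc min (1 / 3) (w / 4) * sqNorm y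
      ≤ min (1 / 3) (w / 4) * (3 * P + 2 * ‖y.1 - y.2.1‖ ^ 2) := by gcongr
    _ = min (1 / 3) (w / 4) * (3 * P) + min (1 / 3) (w / 4) * (2 * ‖y.1 - y.2.1‖ ^ 2) :=
      mul_add _ _ _
    _ ≤ 1 / 3 * (3 * P) + w / 4 * (2 * ‖y.1 - y.2.1‖ ^ 2) := by
      gcongr
      exacts [min_le_left _ _, min_le_right _ _]
    _ ≤ lyapunov N S α γ μ η y := by
      rw [lyapunov, displacementFunctional]
      linarith [(abs_le.1 (hcross S hS y)).1]

theorem exists_lyapunov_le (hα : 0 < α) (hγ : 0 < γ) (hμ : 0 ≤ μ) {N : ℝ} (hN : 0 ≤ N) :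
    ∃ C > 0, ∀ S : H →L[ℝ] H, ‖S‖ ≤ s → ∀ y : State H,
      lyapunov N S α γ μ η y ≤ C * sqNorm y := by
  obtain ⟨C₁, hC₁, hcore⟩ := exists_coreFunctional_le (H := H) (η := η) (s := s) hα hγ hμ
  obtain ⟨C₂, hC₂, hcross⟩ := exists_abs_cross_le (H := H) η s
  set w := γ / (4 * α ^ 2)
  have hw : 0 < w := by positivity
  refine ⟨N * C₁ + C₂ + w, by positivity, fun S hS y => ?_⟩
  have hd : displacementFunctional y ≤ ‖y.1‖ ^ 2 + ‖y.2.1‖ ^ 2 := by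
    have h := norm_sq_le_two_mul_add (y.1 - y.2.1) y.2.1
    rw [sub_add_cancel] at h
    rw [displacementFunctional]
    linarith
  have hwd := mul_le_mul_of_nonneg_left hd hw.le
  have hrest : 0 ≤ C₂ * ‖y.2.1‖ ^ 2 + w * (‖y.2.2.1‖ ^ 2 + ‖y.2.2.2‖ ^ 2) := by positivity
  have hNcore := mul_le_mul_of_nonneg_left (hcore S hS y) hN
  have hC := (abs_le.1 (hcross S hS y)).2
  rw [lyapunov, add_mul, add_mul, mul_assoc N]
  simp only [sqNorm] at hNcore ⊢
  linarith

theorem exists_mul_sqNorm_le {a : ℝ} (ha : 0 < a) (s : ℝ) :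
    ∃ δ > 0, ∀ S : H →L[ℝ] H, ‖S‖ ≤ s → ∀ (y : State H) (k : H), y.2.2.2 = S k →
      δ * sqNorm y ≤ a * (‖y.1‖ ^ 2 + ‖y.2.1‖ ^ 2) + ‖y.2.2.1‖ ^ 2 + ‖k‖ ^ 2 := by
  obtain ⟨δ, hδ, hδa, hδs⟩ : ∃ δ > 0, δ ≤ a ∧ δ * (1 + s ^ 2) ≤ 1 :=
    ⟨min a (1 / (1 + s ^ 2)), by positivity, min_le_left _ _,
      (le_div_iff₀ (by positivity)).1 (min_le_right _ _)⟩
  refine ⟨δ, hδ, fun S hS y k hk => ?_⟩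
  have hpb := mul_le_mul_of_nonneg_right hδa (by positivity : 0 ≤ ‖y.1‖ ^ 2 + ‖y.2.1‖ ^ 2)
  have hζk := mul_le_mul_of_nonneg_right hδs (by positivity : 0 ≤ ‖y.2.2.1‖ ^ 2 + ‖k‖ ^ 2)
  have hθ := mul_le_mul_of_nonneg_left (norm_sq_apply_le hS k) hδ.le
  have hrest : 0 ≤ δ * s ^ 2 * ‖y.2.2.1‖ ^ 2 + δ * ‖k‖ ^ 2 := by positivity
  rw [sqNorm, hk]
  linarith

theorem exists_lyapunov_dissipation (hα : 0 < α) (hγ : 0 < γ) (hμ : 0 ≤ μ)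
    (hcond : μ * (s ^ 4 + κ ^ 2 / α ^ 2) < κ * η ^ 2) :
    ∃ N₀ : ℝ, ∃ δ > 0, ∀ N ≥ N₀, ∀ S : H →L[ℝ] H, (S : H →ₗ[ℝ] H).IsSymmetric → ‖S‖ ≤ s →
      ∀ {y I t q r g h}, FlowsAt S α γ μ κ η y I t q r g h →
        ∃ D ≤ -(δ * sqNorm (y t)),
          HasDerivWithinAt (fun τ => lyapunov N S α γ μ η (y τ)) D I t := by
  have hη : η ≠ 0 := ne_zero_of_lt_mul_sq (by positivity) hcond
  obtain ⟨c, hc, hcore⟩ := exists_core_dissipation (H := H) hμ hcond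
  obtain ⟨C₁, hC₁, hcoupling⟩ := exists_coupling_dissipation (H := H) (γ := γ) (κ := κ) (α := α)
    (η := η) (s := s) hμ (e := γ / α / 16) (by positivity)
  obtain ⟨C₂, hC₂, hequi⟩ := exists_equipartition_dissipation (H := H) (η := η) hα hγ hμ
  obtain ⟨δ, hδ, hsqNorm⟩ :=
    exists_mul_sqNorm_le (H := H) (by positivity : 0 < γ / α / 8) s
  refine ⟨(4 * C₁ + C₂ + 1) / c, δ, hδ, fun N hN S hS hSs y I t q r g h hy => ?_⟩
  set K := ‖S h‖ ^ 2 + μ * ‖S r‖ ^ 2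
  obtain ⟨D₀, hD₀, hd₀⟩ : ∃ D ≤ -(c * K), HasDerivWithinAt _ D I t :=
    ⟨_, hcore S hSs (S h) (S r), hy.hasDerivWithinAt_coreFunctional hα.ne' hη hS⟩
  obtain ⟨D₁, hD₁, hd₁⟩ : ∃ D ≤ _, HasDerivWithinAt _ D I t :=
    ⟨_, hcoupling S hSs (S h) _ _ _, hy.hasDerivWithinAt_couplingFunctional hη hS⟩
  obtain ⟨D₂, hD₂, hd₂⟩ : ∃ D ≤ _, HasDerivWithinAt _ D I t :=
    ⟨_, hequi (S h) _ _ _, hy.hasDerivWithinAt_equipartitionFunctional hS⟩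
  obtain ⟨D₃, hD₃, hd₃⟩ : ∃ D ≤ _, HasDerivWithinAt _ D I t :=
    ⟨_, displacement_dissipation hα _ _, hy.hasDerivWithinAt_displacementFunctional⟩
  refine ⟨_, ?_, ((hd₀.const_mul N).add ((hd₁.const_mul 4).add hd₂)).add
    (hd₃.const_mul (γ / (4 * α ^ 2)))⟩
  have hND₀ : N * D₀ ≤ N * -(c * K) :=
    mul_le_mul_of_nonneg_left hD₀ (le_trans (by positivity) hN)
  have habsorb := mul_le_mul_of_nonneg_right ((div_le_iff₀ hc).1 hN) (by positivity : 0 ≤ K)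
  have hwD₃ : γ / (4 * α ^ 2) * D₃ ≤ γ / α / 8 * (‖(y t).1‖ ^ 2 - ‖(y t).2.1‖ ^ 2) :=
    (mul_le_mul_of_nonneg_left hD₃ (by positivity)).trans_eq (by field_simp; ring)
  have hδK : δ * sqNorm (y t) ≤
      γ / α / 8 * (‖(y t).1‖ ^ 2 + ‖(y t).2.1‖ ^ 2) + ‖(y t).2.2.1‖ ^ 2 + K :=
    (hsqNorm S hSs (y t) (S h) (by rw [hy.value])).trans
      (add_le_add_right (le_add_of_nonneg_right (by positivity)) _)
  have hp : γ / (2 * α) * ‖(y t).1‖ ^ 2 = γ / α / 2 * ‖(y t).1‖ ^ 2 := by ring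
  linarith

theorem two_mul_lt_of_dissipative (hα : 0 < α) (hκ : 0 < κ) (hμ : 0 ≤ μ)
    (hcond : μ * (s ^ 4 + κ ^ 2 / α ^ 2) < κ * η ^ 2) : 2 * μ * s ^ 2 < α * η ^ 2 := by
  have hsq : 2 * s ^ 2 * (κ / α) ≤ s ^ 4 + κ ^ 2 / α ^ 2 := by
    rw [← div_pow]
    linarith [two_mul_le_add_sq (s ^ 2) (κ / α)]
  have h : μ * (2 * s ^ 2 * (κ / α)) < κ * η ^ 2 :=
    (mul_le_mul_of_nonneg_left hsq hμ).trans_lt hcond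
  have hrw : μ * (2 * s ^ 2 * (κ / α)) = 2 * μ * s ^ 2 * κ / α := by ring
  rw [hrw, div_lt_iff₀ hα] at h
  nlinarith

theorem exists_lyapunov (hα : 0 < α) (hγ : 0 < γ) (hκ : 0 < κ) (hμ : 0 ≤ μ)
    (hcond : μ * (s ^ 4 + κ ^ 2 / α ^ 2) < κ * η ^ 2) :
    ∃ N c C δ : ℝ, 0 < c ∧ 0 < C ∧ 0 < δ ∧
      ∀ S : H →L[ℝ] H, (S : H →ₗ[ℝ] H).IsSymmetric → ‖S‖ ≤ s →
        (∀ y, c * sqNorm y ≤ lyapunov N S α γ μ η y ∧ lyapunov N S α γ μ η y ≤ C * sqNorm y) ∧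
        ∀ {y I t q r g h}, FlowsAt S α γ μ κ η y I t q r g h →
          ∃ D ≤ -(δ * sqNorm (y t)),
            HasDerivWithinAt (fun τ => lyapunov N S α γ μ η (y τ)) D I t := by
  obtain ⟨N₁, c, hc, hle⟩ := exists_le_lyapunov (H := H) hα hγ hμ
    (two_mul_lt_of_dissipative hα hκ hμ hcond)
  obtain ⟨N₂, δ, hδ, hdiss⟩ := exists_lyapunov_dissipation (H := H) hα hγ hμ hcond
  set N := max 0 (max N₁ N₂)
  have hN₁ : N ≥ N₁ := (le_max_left _ _).trans (le_max_right _ _)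
  have hN₂ : N ≥ N₂ := (le_max_right _ _).trans (le_max_right _ _)
  obtain ⟨C, hC, hge⟩ := exists_lyapunov_le (H := H) (η := η) (s := s) hα hγ hμ
    (le_max_left 0 (max N₁ N₂))
  exact ⟨N, c, C, δ, hc, hC, hδ, fun S hS hSs =>
    ⟨fun y => ⟨hle N hN₁ S hSs y, hge S hSs y⟩, hdiss N hN₂ S hS hSs⟩⟩

end Lyapunov

/-! ### Exponential decay of strong solutions -/

theorem le_mul_exp_of_deriv_le {f f' : ℝ → ℝ} {ω : ℝ}
    (hf : ∀ t, 0 ≤ t → HasDerivWithinAt f (f' t) (Ici 0) t)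
    (hle : ∀ t, 0 ≤ t → f' t ≤ -ω * f t) {t : ℝ} (ht : 0 ≤ t) :
    f t ≤ f 0 * Real.exp (-ω * t) := by
  have h := le_gronwallBound_of_liminf_deriv_right_le (f := f) (f' := f') (δ := f 0) (K := -ω)
    (ε := 0) (a := 0) (b := t) (fun τ hτ => (hf τ hτ.1).continuousWithinAt.mono Icc_subset_Ici_self)
    (fun τ hτ r hr => ((hf τ hτ.1).mono (Ici_subset_Ici.2 hτ.1)).liminf_right_slope_le hr)
    le_rfl (fun τ hτ => by simpa using hle τ hτ.1) t (right_mem_Icc.2 ht)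
  rwa [gronwallBound_ε0, sub_zero] at h

/-- On `[0, ∞)` the curve `y` stays in the domain of the generator and solves the system. -/
def IsStrongSolution (S : H →L[ℝ] H) (α γ μ κ η : ℝ) (y : ℝ → State H) : Prop :=
  ∀ t, 0 ≤ t → ∃ q r g h, FlowsAt S α γ μ κ η y (Ici 0) t q r g h

theorem exists_uniform_decay {α γ μ κ η s : ℝ} (hα : 0 < α) (hγ : 0 < γ) (hκ : 0 < κ)
    (hμ : 0 ≤ μ) (hcond : μ * (s ^ 4 + κ ^ 2 / α ^ 2) < κ * η ^ 2) :
    ∃ M ω : ℝ, 0 < M ∧ 0 < ω ∧ ∀ S : H →L[ℝ] H, (S : H →ₗ[ℝ] H).IsSymmetric → ‖S‖ ≤ s →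
      ∀ y, IsStrongSolution S α γ μ κ η y →
        ∀ t, 0 ≤ t → sqNorm (y t) ≤ M * sqNorm (y 0) * Real.exp (-ω * t) := by
  obtain ⟨N, c, C, δ, hc, hC, hδ, hV⟩ := exists_lyapunov (H := H) hα hγ hκ hμ hcond
  refine ⟨C / c, δ / C, by positivity, by positivity, fun S hS hSs y hy t ht => ?_⟩
  obtain ⟨hbounds, hdiss⟩ := hV S hS hSs
  set V := fun τ => lyapunov N S α γ μ η (y τ)
  have hderiv (τ : ℝ) (hτ : 0 ≤ τ) :
      ∃ D ≤ -(δ / C) * V τ, HasDerivWithinAt V D (Ici 0) τ := by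
    obtain ⟨q, r, g, h, hflow⟩ := hy τ hτ
    obtain ⟨D, hD, hVD⟩ := hdiss hflow
    refine ⟨D, hD.trans ?_, hVD⟩
    rw [neg_mul, neg_le_neg_iff, div_mul_eq_mul_div, div_le_iff₀ hC, mul_assoc, mul_comm _ C]
    exact mul_le_mul_of_nonneg_left (hbounds (y τ)).2 hδ.le
  choose! D hD hVD using hderiv
  have hdecay : V t ≤ V 0 * Real.exp (-(δ / C) * t) := le_mul_exp_of_deriv_le hVD hD ht
  have hrw : C / c * sqNorm (y 0) * Real.exp (-(δ / C) * t)
      = C * sqNorm (y 0) * Real.exp (-(δ / C) * t) / c := by ring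
  rw [hrw, le_div_iff₀ hc, mul_comm]
  calc c * sqNorm (y t) ≤ V t := (hbounds (y t)).1
    _ ≤ V 0 * Real.exp (-(δ / C) * t) := hdecay
    _ ≤ C * sqNorm (y 0) * Real.exp (-(δ / C) * t) := by
      gcongr
      exact (hbounds (y 0)).2

/-! ### Differentiation on the half-line through integral equations -/

section HalfLine

open MeasureTheory

theorem intervalIntegrable_of_continuousOn_Ici {E : Type*} [NormedAddCommGroup E] {f : ℝ → E}
    (hf : ContinuousOn f (Ici 0)) {t : ℝ} (ht : 0 ≤ t) : IntervalIntegrable f volume 0 t :=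
  (hf.mono (by rw [uIcc_of_le ht]; exact Icc_subset_Ici_self)).intervalIntegrable

variable {E : Type*} [NormedAddCommGroup E] [NormedSpace ℝ E] [CompleteSpace E]

theorem integral_eq_sub_of_hasDerivWithinAt_Ici {f f' : ℝ → E}
    (hf : ∀ t, 0 ≤ t → HasDerivWithinAt f (f' t) (Ici 0) t) (hf' : ContinuousOn f' (Ici 0))
    {t : ℝ} (ht : 0 ≤ t) : ∫ τ in (0 : ℝ)..t, f' τ = f t - f 0 :=
  intervalIntegral.integral_eq_sub_of_hasDeriv_right_of_le ht
    (fun τ hτ => (hf τ hτ.1).continuousWithinAt.mono Icc_subset_Ici_self)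
    (fun τ hτ => (hf τ hτ.1.le).mono (Ioi_subset_Ici hτ.1.le))
    (intervalIntegrable_of_continuousOn_Ici hf' ht)

theorem hasDerivWithinAt_of_integral_eq_sub {f f' : ℝ → E} (hf' : ContinuousOn f' (Ici 0))
    (h : ∀ t, 0 ≤ t → ∫ τ in (0 : ℝ)..t, f' τ = f t - f 0) {t : ℝ} (ht : 0 ≤ t) :
    HasDerivWithinAt f (f' t) (Ici 0) t := by
  have hext : Continuous fun τ => f' (max τ 0) :=
    hf'.comp_continuous (by fun_prop) fun τ => le_max_right τ 0
  have hint := ((hext.integral_hasStrictDerivAt 0 t).hasDerivAt.hasDerivWithinAt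
    (s := Ici (0 : ℝ))).const_add (f 0)
  rw [max_eq_left ht] at hint
  have heq (τ : ℝ) (hτ : 0 ≤ τ) : f τ = f 0 + ∫ σ in (0 : ℝ)..τ, f' (max σ 0) := by
    rw [← sub_eq_iff_eq_add', ← h τ hτ]
    refine intervalIntegral.integral_congr fun σ hσ => ?_
    rw [uIcc_of_le hτ] at hσ
    exact congrArg f' (max_eq_left hσ.1).symm
  exact hint.congr heq (heq t ht)

theorem hasDerivWithinAt_of_separating {ι F : Type*} [NormedAddCommGroup F] [NormedSpace ℝ F]
    [CompleteSpace F] {L : ι → E →L[ℝ] F} (hL : ∀ x, (∀ i, L i x = 0) → x = 0) {f f' : ℝ → E}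
    (hf' : ContinuousOn f' (Ici 0))
    (hf : ∀ i t, 0 ≤ t → HasDerivWithinAt (fun τ => L i (f τ)) (L i (f' t)) (Ici 0) t) {t : ℝ}
    (ht : 0 ≤ t) : HasDerivWithinAt f (f' t) (Ici 0) t := by
  refine hasDerivWithinAt_of_integral_eq_sub hf' (fun t ht => ?_) ht
  refine sub_eq_zero.1 (hL _ fun i => ?_)
  rw [map_sub, map_sub, sub_eq_zero, ← (L i).intervalIntegral_comp_comm
    (intervalIntegrable_of_continuousOn_Ici hf' ht)]
  exact integral_eq_sub_of_hasDerivWithinAt_Ici (hf i)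
    ((L i).continuous.comp_continuousOn hf') ht

theorem hasDerivWithinAt_of_injective {F : Type*} [NormedAddCommGroup F] [NormedSpace ℝ F]
    [CompleteSpace F] {L : E →L[ℝ] F} (hL : Function.Injective L) {f f' : ℝ → E}
    (hf' : ContinuousOn f' (Ici 0))
    (hf : ∀ t, 0 ≤ t → HasDerivWithinAt (fun τ => L (f τ)) (L (f' t)) (Ici 0) t) {t : ℝ}
    (ht : 0 ≤ t) : HasDerivWithinAt f (f' t) (Ici 0) t :=
  hasDerivWithinAt_of_separating (ι := Unit) (L := fun _ => L)
    (fun _ hx => hL ((hx ()).trans (map_zero L).symm)) hf' (fun _ => hf) ht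

theorem hasDerivWithinAt_of_tendsto {f f' : ℕ → ℝ → E} {g g' : ℝ → E} {C : ℝ}
    (hf : ∀ n t, 0 ≤ t → HasDerivWithinAt (f n) (f' n t) (Ici 0) t)
    (hf' : ∀ n, ContinuousOn (f' n) (Ici 0)) (hC : ∀ n t, 0 ≤ t → ‖f' n t‖ ≤ C)
    (hfg : ∀ t, 0 ≤ t → Tendsto (fun n => f n t) atTop (𝓝 (g t)))
    (hfg' : ∀ t, 0 ≤ t → Tendsto (fun n => f' n t) atTop (𝓝 (g' t)))
    (hg' : ContinuousOn g' (Ici 0)) {t : ℝ} (ht : 0 ≤ t) :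
    HasDerivWithinAt g (g' t) (Ici 0) t := by
  refine hasDerivWithinAt_of_integral_eq_sub hg' (fun t ht => ?_) ht
  have hnonneg {τ : ℝ} (hτ : τ ∈ uIoc 0 t) : 0 ≤ τ := by
    rw [uIoc_of_le ht] at hτ
    exact hτ.1.le
  have hint : Tendsto (fun n => ∫ τ in (0 : ℝ)..t, f' n τ) atTop
      (𝓝 (∫ τ in (0 : ℝ)..t, g' τ)) :=
    intervalIntegral.tendsto_integral_filter_of_dominated_convergence (fun _ => C)
      (Eventually.of_forall fun n =>
        (intervalIntegrable_of_continuousOn_Ici (hf' n) ht).aestronglyMeasurable_restrict_uIoc)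
      (Eventually.of_forall fun n => Eventually.of_forall fun τ hτ => hC n τ (hnonneg hτ))
      intervalIntegrable_const (Eventually.of_forall fun τ hτ => hfg' τ (hnonneg hτ))
  refine tendsto_nhds_unique hint (((hfg t ht).sub (hfg 0 le_rfl)).congr fun n => ?_)
  exact (integral_eq_sub_of_hasDerivWithinAt_Ici (hf n) (hf' n) ht).symm

end HalfLine

/-! ### Limits of uniformly continuous semigroups -/

section Semigroup

open NormedSpace (exp)

theorem norm_exp_mul_sub_exp_mul_le {𝔸 : Type*} [NormedRing 𝔸] [NormedAlgebra ℝ 𝔸]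
    [CompleteSpace 𝔸] {a b j : 𝔸} {K : ℝ} (ha : ∀ t : ℝ, 0 ≤ t → ‖exp (t • a)‖ ≤ K)
    (hb : ∀ t : ℝ, 0 ≤ t → ‖exp (t • b)‖ ≤ K) (hj : Commute j b) {t : ℝ} (ht : 0 ≤ t) :
    ‖exp (t • b) * j - exp (t • a) * j‖ ≤ K * ‖b * j - a * j‖ * K * t := by
  have hK : 0 ≤ K := (norm_nonneg _).trans (ha 0 le_rfl)
  -- Duhamel's formula: interpolate by `exp ((t - s) a) exp (s b) j`.
  have hderiv (s : ℝ) : HasDerivAt (fun s : ℝ => exp ((t - s) • a) * (exp (s • b) * j))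
      (exp ((t - s) • a) * (b * j - a * j) * exp (s • b)) s := by
    have hleft := (hasDerivAt_exp_smul_const (𝕂 := ℝ) a (t - s)).scomp s
      ((hasDerivAt_id s).const_sub t)
    have hright := (hasDerivAt_exp_smul_const' (𝕂 := ℝ) b s).mul_const j
    refine (hleft.mul hright).congr_deriv ?_
    have hcomm : exp (s • b) * j = j * exp (s • b) := ((hj.smul_right s).exp_right).eq.symm
    simp only [Function.comp_apply, neg_smul, one_smul, neg_mul, mul_assoc, hcomm, mul_sub, sub_mul]
    abel
  have hbound (s : ℝ) (hs : s ∈ Icc 0 t) :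
      ‖exp ((t - s) • a) * (b * j - a * j) * exp (s • b)‖ ≤ K * ‖b * j - a * j‖ * K := by
    refine (norm_mul_le _ _).trans (mul_le_mul ((norm_mul_le _ _).trans ?_) (hb s hs.1)
      (norm_nonneg _) (by positivity))
    exact mul_le_mul_of_nonneg_right (ha (t - s) (sub_nonneg.2 hs.2)) (norm_nonneg _)
  have hmean := (convex_Icc (0 : ℝ) t).norm_image_sub_le_of_norm_hasDerivWithin_le
    (fun s _ => (hderiv s).hasDerivWithinAt) hbound (left_mem_Icc.2 ht) (right_mem_Icc.2 ht)
  simpa only [sub_self, zero_smul, NormedSpace.exp_zero, one_mul, sub_zero,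
    Real.norm_of_nonneg ht] using hmean

variable {X : Type*} [NormedAddCommGroup X] [NormedSpace ℝ X] [CompleteSpace X]

theorem hasDerivAt_exp_smul_apply (G : X →L[ℝ] X) (x : X) (t : ℝ) :
    HasDerivAt (fun τ : ℝ => exp (τ • G) x) (G (exp (t • G) x)) t := by
  simpa using (hasDerivAt_exp_smul_const' (𝕂 := ℝ) G t).clm_apply (hasDerivAt_const t x)

theorem continuous_exp_smul_apply (G : X →L[ℝ] X) (x : X) :
    Continuous fun t : ℝ => exp (t • G) x :=
  continuous_iff_continuousAt.2 fun t => (hasDerivAt_exp_smul_apply G x t).continuousAt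

theorem norm_exp_apply_sub_exp_apply_le {G G' J : X →L[ℝ] X} {K : ℝ}
    (hG : ∀ t : ℝ, 0 ≤ t → ‖exp (t • G)‖ ≤ K) (hG' : ∀ t : ℝ, 0 ≤ t → ‖exp (t • G')‖ ≤ K)
    (hJ : Commute J G') (x z : X) {t : ℝ} (ht : 0 ≤ t) :
    ‖exp (t • G') x - exp (t • G) x‖ ≤
      2 * K * ‖x - J z‖ + K ^ 2 * t * ‖z‖ * ‖G' * J - G * J‖ := by
  have hsplit : exp (t • G') x - exp (t • G) x = exp (t • G') (x - J z) - exp (t • G) (x - J z) +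
      (exp (t • G') * J - exp (t • G) * J) z := by
    simp only [map_sub, sub_apply, mul_apply_eq_comp]
    abel
  have happly {T : X →L[ℝ] X} (hT : ‖T‖ ≤ K) : ‖T (x - J z)‖ ≤ K * ‖x - J z‖ :=
    T.le_of_opNorm_le hT _
  calc ‖exp (t • G') x - exp (t • G) x‖
      ≤ K * ‖x - J z‖ + K * ‖x - J z‖ + K * ‖G' * J - G * J‖ * K * t * ‖z‖ := by
        rw [hsplit]
        exact (norm_add_le _ _).trans (add_le_add ((norm_sub_le _ _).trans
          (add_le_add (happly (hG' t ht)) (happly (hG t ht))))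
          (ContinuousLinearMap.le_of_opNorm_le _ (norm_exp_mul_sub_exp_mul_le hG hG' hJ ht) z))
    _ = _ := by ring

variable {G : ℕ → X →L[ℝ] X} {J B : X →L[ℝ] X} {K : ℝ}

theorem uniformCauchySeqOn_exp_smul_apply (hG : ∀ n (t : ℝ), 0 ≤ t → ‖exp (t • G n)‖ ≤ K)
    (hJ : ∀ n, Commute J (G n)) (hJd : DenseRange J)
    (hB : Tendsto (fun n => G n * J) atTop (𝓝 B)) (x : X) (τ : ℝ) :
    UniformCauchySeqOn (fun n t => exp (t • G n) x) atTop (Icc 0 τ) := by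
  rw [Metric.uniformCauchySeqOn_iff]
  intro e he
  have hK : 0 ≤ K := (norm_nonneg _).trans (hG 0 0 le_rfl)
  obtain ⟨z, hz⟩ := hJd.exists_dist_lt x (ε := e / (2 * (2 * K + 1))) (by positivity)
  obtain ⟨N, hN⟩ := Metric.cauchySeq_iff.1 hB.cauchySeq
    (e / (2 * (K ^ 2 * |τ| * ‖z‖ + 1))) (by positivity)
  refine ⟨N, fun m hm n hn t ht => ?_⟩
  have hz' : (2 * K + 1) * ‖x - J z‖ < e / 2 := by
    rw [dist_eq_norm, lt_div_iff₀ (by positivity)] at hz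
    linarith
  have hmn : (K ^ 2 * |τ| * ‖z‖ + 1) * ‖G m * J - G n * J‖ < e / 2 := by
    have h := hN m hm n hn
    rw [dist_eq_norm, lt_div_iff₀ (by positivity)] at h
    linarith
  have htτ : t ≤ |τ| := ht.2.trans (le_abs_self τ)
  rw [dist_eq_norm]
  calc ‖exp (t • G m) x - exp (t • G n) x‖
      ≤ 2 * K * ‖x - J z‖ + K ^ 2 * t * ‖z‖ * ‖G m * J - G n * J‖ :=
        norm_exp_apply_sub_exp_apply_le (hG n) (hG m) (hJ m) x z ht.1
    _ ≤ (2 * K + 1) * ‖x - J z‖ + (K ^ 2 * |τ| * ‖z‖ + 1) * ‖G m * J - G n * J‖ := by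
        gcongr <;> nlinarith [norm_nonneg z, mul_nonneg (sq_nonneg K) (norm_nonneg z)]
    _ < e := by linarith

theorem exists_tendsto_exp_smul_apply (hG : ∀ n (t : ℝ), 0 ≤ t → ‖exp (t • G n)‖ ≤ K)
    (hJ : ∀ n, Commute J (G n)) (hJd : DenseRange J)
    (hB : Tendsto (fun n => G n * J) atTop (𝓝 B)) (x : X) :
    ∃ y : ℝ → X, ContinuousOn y (Ici 0) ∧
      ∀ t, 0 ≤ t → Tendsto (fun n => exp (t • G n) x) atTop (𝓝 (y t)) := by
  have hcauchy := uniformCauchySeqOn_exp_smul_apply hG hJ hJd hB x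
  have hlim (t : ℝ) (ht : 0 ≤ t) : ∃ y, Tendsto (fun n => exp (t • G n) x) atTop (𝓝 y) :=
    cauchySeq_tendsto_of_complete ((hcauchy t).cauchySeq (right_mem_Icc.2 ht))
  choose! y hy using hlim
  refine ⟨y, fun t ht => ?_, hy⟩
  have huniform := (hcauchy (t + 1)).tendstoUniformlyOn_of_tendsto fun τ hτ => hy τ hτ.1
  have hcont : ContinuousOn y (Icc 0 (t + 1)) := huniform.continuousOn
    (Frequently.of_forall fun n => (continuous_exp_smul_apply (G n) x).continuousOn)
  refine (hcont t ⟨ht, (lt_add_one t).le⟩).mono_of_mem_nhdsWithin ?_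
  rw [← Ici_inter_Iic]
  exact inter_mem_nhdsWithin _ (Iic_mem_nhds (lt_add_one t))

theorem hasDerivWithinAt_of_tendsto_exp_smul_apply
    (hG : ∀ n (t : ℝ), 0 ≤ t → ‖exp (t • G n)‖ ≤ K) (hJ : ∀ n, Commute J (G n))
    (hB : Tendsto (fun n => G n * J) atTop (𝓝 B)) {x : X} {y : ℝ → X}
    (hyc : ContinuousOn y (Ici 0))
    (hy : ∀ t, 0 ≤ t → Tendsto (fun n => exp (t • G n) x) atTop (𝓝 (y t))) {t : ℝ} (ht : 0 ≤ t) :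
    HasDerivWithinAt (fun τ => J (y τ)) (B (y t)) (Ici 0) t := by
  obtain ⟨b, hb⟩ := hB.norm.bddAbove_range
  have hderiv (n : ℕ) (τ : ℝ) :
      HasDerivAt (fun τ : ℝ => J (exp (τ • G n) x)) ((G n * J) (exp (τ • G n) x)) τ := by
    rw [← (hJ n).eq]
    exact J.hasFDerivAt.comp_hasDerivAt τ (hasDerivAt_exp_smul_apply (G n) x τ)
  have hbound (n : ℕ) (τ : ℝ) (hτ : 0 ≤ τ) : ‖(G n * J) (exp (τ • G n) x)‖ ≤ b * (K * ‖x‖) :=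
    (G n * J).le_of_opNorm_le_of_le (hb ⟨n, rfl⟩)
      (ContinuousLinearMap.le_of_opNorm_le _ (hG n τ hτ) x)
  exact hasDerivWithinAt_of_tendsto (fun n τ _ => (hderiv n τ).hasDerivWithinAt)
    (fun n => ((G n * J).continuous.comp (continuous_exp_smul_apply (G n) x)).continuousOn)
    hbound (fun τ hτ => (J.continuous.tendsto _).comp (hy τ hτ))
    (fun τ hτ => (isBoundedBilinearMap_apply.continuous.tendsto (B, y τ)).comp
      (hB.prodMk_nhds (hy τ hτ))) (B.continuous.comp_continuousOn hyc) ht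

end Semigroup

/-! ### Bounded approximations of an unbounded inverse -/

section ShiftInverse

/-- The bounded operator `(S + ε)⁻¹`, which approximates `S⁻¹` as `ε → 0` when `S` is positive and
injective. -/
noncomputable def shiftInverse (S : H →L[ℝ] H) (ε : ℝ) : H →L[ℝ] H :=
  Ring.inverse (S + ε • 1)

variable {S : H →L[ℝ] H} {ε : ℝ}

theorem commute_shiftInverse : Commute S (shiftInverse S ε) := by
  have h : Commute S (S + ε • 1) :=
    (Commute.refl S).add_right ((Commute.one_right S).smul_right ε)
  by_cases hu : IsUnit (S + ε • (1 : H →L[ℝ] H))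
  · obtain ⟨u, hu⟩ := hu
    rw [shiftInverse, ← hu, Ring.inverse_unit]
    exact (hu ▸ h : Commute S u).units_inv_right
  · rw [shiftInverse, Ring.inverse_non_unit _ hu]
    exact Commute.zero_right S

variable [CompleteSpace H]

theorem isUnit_add_smul_one (hS : S.IsPositive) (hε : 0 < ε) :
    IsUnit (S + ε • (1 : H →L[ℝ] H)) := by
  refine ContinuousLinearMap.isUnit_of_forall_le_norm_inner_map _ (c := ⟨ε, hε.le⟩) hε fun x => ?_
  have h : ⟪(S + ε • (1 : H →L[ℝ] H)) x, x⟫_ℝ = ⟪S x, x⟫_ℝ + ε * ‖x‖ ^ 2 := by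
    simp [inner_add_left, real_inner_smul_left]
  calc ‖x‖ ^ 2 * ε ≤ ⟪S x, x⟫_ℝ + ε * ‖x‖ ^ 2 := by
        linarith [hS.inner_nonneg_left x]
    _ ≤ ‖⟪(S + ε • (1 : H →L[ℝ] H)) x, x⟫_ℝ‖ := by
        rw [h]
        exact le_abs_self _

theorem add_smul_one_mul_shiftInverse (hS : S.IsPositive) (hε : 0 < ε) :
    (S + ε • 1) * shiftInverse S ε = 1 :=
  Ring.mul_inverse_cancel _ (isUnit_add_smul_one hS hε)

theorem mul_shiftInverse_eq (hS : S.IsPositive) (hε : 0 < ε) :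
    S * shiftInverse S ε = 1 - ε • shiftInverse S ε := by
  rw [eq_sub_iff_add_eq, ← add_smul_one_mul_shiftInverse hS hε, add_mul, smul_mul_assoc, one_mul]

theorem norm_mul_shiftInverse_le (hS : S.IsPositive) (hε : 0 < ε) :
    ‖S * shiftInverse S ε‖ ≤ 1 := by
  refine ContinuousLinearMap.opNorm_le_bound _ zero_le_one fun x => ?_
  set z := shiftInverse S ε x
  have hz : S z + ε • z = x := DFunLike.congr_fun (add_smul_one_mul_shiftInverse hS hε) x
  have hcross : 0 ≤ ⟪S z, ε • z⟫_ℝ := by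
    rw [inner_smul_right]
    exact mul_nonneg hε.le (hS.inner_nonneg_left z)
  have hsq : ‖S z‖ ^ 2 ≤ ‖S z + ε • z‖ ^ 2 := by
    rw [norm_add_sq_real]
    linarith [sq_nonneg ‖ε • z‖]
  rw [hz] at hsq
  rw [one_mul]
  exact le_of_sq_le_sq hsq (norm_nonneg _)

variable {ε : ℕ → ℝ}

theorem tendsto_shiftInverse_mul_cube (hS : S.IsPositive) (hε : ∀ n, 0 < ε n)
    (hε₀ : Tendsto ε atTop (𝓝 0)) :
    Tendsto (fun n => shiftInverse S (ε n) * (S * S * S)) atTop (𝓝 (S * S)) := by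
  have hrw (n : ℕ) : shiftInverse S (ε n) * (S * S * S) =
      S * S - ε n • (S * shiftInverse S (ε n) * S) := by
    have hcomm : shiftInverse S (ε n) * S = S * shiftInverse S (ε n) :=
      commute_shiftInverse.symm.eq
    rw [← mul_assoc, ← mul_assoc, hcomm]
    conv_lhs => rw [mul_shiftInverse_eq hS (hε n)]
    rw [sub_mul, sub_mul, one_mul, smul_mul_assoc, smul_mul_assoc, hcomm]
  refine tendsto_iff_norm_sub_tendsto_zero.2 (squeeze_zero (fun _ => norm_nonneg _) (fun n => ?_)
    (by simpa using hε₀.mul_const ‖S‖))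
  rw [hrw, sub_sub_cancel_left, norm_neg, norm_smul, Real.norm_of_nonneg (hε n).le]
  refine mul_le_mul_of_nonneg_left ((norm_mul_le _ _).trans ?_) (hε n).le
  exact mul_le_of_le_one_left (norm_nonneg _) (norm_mul_shiftInverse_le hS (hε n))

theorem tendsto_shiftInverse_sq_mul_cube (hS : S.IsPositive) (hε : ∀ n, 0 < ε n)
    (hε₀ : Tendsto ε atTop (𝓝 0)) :
    Tendsto (fun n => shiftInverse S (ε n) * shiftInverse S (ε n) * (S * S * S)) atTop
      (𝓝 S) := by
  have hrw (n : ℕ) : shiftInverse S (ε n) * shiftInverse S (ε n) * (S * S * S) =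
      S - ε n • (S * shiftInverse S (ε n) +
        S * shiftInverse S (ε n) * (S * shiftInverse S (ε n))) := by
    set R := shiftInverse S (ε n)
    have hcomm : R * S = S * R := commute_shiftInverse.symm.eq
    have hSR : S * R = 1 - ε n • R := mul_shiftInverse_eq hS (hε n)
    have hSRS : S * R * S = S - ε n • (S * R) := by
      rw [hSR, sub_mul, one_mul, smul_mul_assoc, hcomm, hSR]
    calc R * R * (S * S * S) = R * (R * S) * S * S := by simp only [mul_assoc]
      _ = R * (S * R) * S * S := by rw [hcomm]
      _ = R * S * (R * S) * S := by simp only [mul_assoc]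
      _ = S * R * (S * R * S) := by rw [hcomm, mul_assoc]
      _ = S * R * S - ε n • (S * R * (S * R)) := by
        conv_lhs => rw [hSRS, mul_sub, mul_smul_comm]
      _ = S - ε n • (S * R + S * R * (S * R)) := by rw [hSRS, smul_add, sub_add_eq_sub_sub]
  refine tendsto_iff_norm_sub_tendsto_zero.2 (squeeze_zero (fun _ => norm_nonneg _) (fun n => ?_)
    (by simpa using hε₀.mul_const (1 + 1)))
  rw [hrw, sub_sub_cancel_left, norm_neg, norm_smul, Real.norm_of_nonneg (hε n).le]
  have hle := norm_mul_shiftInverse_le hS (hε n)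
  refine mul_le_mul_of_nonneg_left ((norm_add_le _ _).trans (add_le_add hle ?_)) (hε n).le
  exact (norm_mul_le _ _).trans (mul_le_one₀ hle (norm_nonneg _) hle)

theorem denseRange_of_isSymmetric_of_injective (hS : (S : H →ₗ[ℝ] H).IsSymmetric)
    (hinj : Function.Injective S) : DenseRange S := by
  have h : (LinearMap.range (S : H →ₗ[ℝ] H)).topologicalClosure = ⊤ := by
    rw [Submodule.topologicalClosure_eq_top_iff, Submodule.eq_bot_iff]
    intro z hz
    rw [Submodule.mem_orthogonal] at hz
    have hSz : ⟪S z, S z⟫_ℝ = 0 := (hS z (S z)).trans <| by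
      rw [real_inner_comm]
      exact hz _ ⟨S z, rfl⟩
    exact hinj ((inner_self_eq_zero.1 hSz).trans (map_zero S).symm)
  exact Submodule.dense_iff_topologicalClosure_eq_top.2 h

end ShiftInverse

/-! ### The generator of the system -/

section Generator

variable {α γ μ κ η : ℝ}

/-- The operator `T` acting on each coordinate. -/
noncomputable def diag (T : H →L[ℝ] H) : State H →L[ℝ] State H :=
  T.prodMap (T.prodMap (T.prodMap T))

open ContinuousLinearMap in
/-- For `(I, R, L) = (1, A^{1/2}, A)` this is, formally, the generator of the system in the
coordinates of `State H`; a bounded operator results when `A^{1/2}` is replaced by a bounded one,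
or when the three entries are premultiplied by `A⁻¹`. -/
noncomputable def systemOp (α γ μ κ η : ℝ) (I R L : H →L[ℝ] H) : State H →L[ℝ] State H :=
  let p := fst ℝ H (H × H × H)
  let b := fst ℝ H (H × H) ∘L snd ℝ H (H × H × H)
  let ζ := fst ℝ H H ∘L snd ℝ H (H × H) ∘L snd ℝ H (H × H × H)
  let θ := snd ℝ H H ∘L snd ℝ H (H × H) ∘L snd ℝ H (H × H × H)
  (R ∘L ζ).prod ((R ∘L ζ - α • (I ∘L b)).prod
    ((η • (L ∘L θ) - (γ / α) • (R ∘L p) + (μ / α) • (R ∘L b)).prod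
      (-(κ • (L ∘L θ)) - η • (L ∘L ζ))))

theorem diag_apply (T : H →L[ℝ] H) (y : State H) :
    diag T y = (T y.1, T y.2.1, T y.2.2.1, T y.2.2.2) := rfl

theorem systemOp_apply (I R L : H →L[ℝ] H) (y : State H) :
    systemOp α γ μ κ η I R L y = (R y.2.2.1, R y.2.2.1 - α • I y.2.1,
      η • L y.2.2.2 - (γ / α) • R y.1 + (μ / α) • R y.2.1,
      -(κ • L y.2.2.2) - η • L y.2.2.1) := rfl

theorem diag_injective {T : H →L[ℝ] H} (hT : Function.Injective T) :
    Function.Injective (diag T) :=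
  hT.prodMap (hT.prodMap (hT.prodMap hT))

theorem denseRange_diag {T : H →L[ℝ] H} (hT : DenseRange T) : DenseRange (diag T) :=
  hT.prodMap (hT.prodMap (hT.prodMap hT))

theorem diag_mul_diag (T T' : H →L[ℝ] H) : diag T * diag T' = diag (T * T') := rfl

theorem diag_mul_systemOp (T I R L : H →L[ℝ] H) :
    diag T * systemOp α γ μ κ η I R L = systemOp α γ μ κ η (T * I) (T * R) (T * L) := by
  refine ContinuousLinearMap.ext fun y => ?_
  simp only [mul_apply_eq_comp, systemOp_apply, diag_apply, map_add, map_sub, map_neg, map_smul]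

theorem systemOp_mul_diag (T I R L : H →L[ℝ] H) :
    systemOp α γ μ κ η I R L * diag T = systemOp α γ μ κ η (I * T) (R * T) (L * T) := rfl

@[fun_prop]
theorem continuous_clm_prod {T E F G : Type*} [TopologicalSpace T] [NormedAddCommGroup E]
    [NormedSpace ℝ E] [NormedAddCommGroup F] [NormedSpace ℝ F] [NormedAddCommGroup G]
    [NormedSpace ℝ G] {f : T → E →L[ℝ] F} {g : T → E →L[ℝ] G} (hf : Continuous f)
    (hg : Continuous g) : Continuous fun τ => (f τ).prod (g τ) :=
  (ContinuousLinearMap.prodₗᵢ ℝ).continuous.comp (hf.prodMk hg)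

theorem continuous_systemOp :
    Continuous fun c : (H →L[ℝ] H) × (H →L[ℝ] H) × (H →L[ℝ] H) =>
      systemOp α γ μ κ η c.1 c.2.1 c.2.2 := by
  unfold systemOp
  fun_prop

theorem flowsAt_of_hasDerivWithinAt {S : H →L[ℝ] H} {y : ℝ → State H} {x : State H} {I : Set ℝ}
    {t : ℝ} (hy : y t = diag (S * S) x)
    (hd : HasDerivWithinAt y (systemOp α γ μ κ η (S * S) S 1 x) I t) :
    FlowsAt S α γ μ κ η y I t (S x.1) (S x.2.1) x.2.2.1 x.2.2.2 :=
  ⟨hy, hd⟩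

end Generator

/-! ### Regularized solutions -/

section Regularized

variable {α γ μ κ η s : ℝ} {S : H →L[ℝ] H}

theorem sqNorm_nonneg {E : Type*} [NormedAddCommGroup E] (y : State E) : 0 ≤ sqNorm y := by
  unfold sqNorm
  positivity

theorem norm_sq_le_sqNorm {E : Type*} [NormedAddCommGroup E] (y : State E) :
    ‖y‖ ^ 2 ≤ sqNorm y := by
  have h : ‖y‖ ≤ √(sqNorm y) := by
    simp only [Prod.norm_def, max_le_iff]
    refine ⟨?_, ?_, ?_, ?_⟩ <;> refine Real.le_sqrt_of_sq_le ?_ <;> unfold sqNorm <;>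
      linarith [sq_nonneg ‖y.1‖, sq_nonneg ‖y.2.1‖, sq_nonneg ‖y.2.2.1‖, sq_nonneg ‖y.2.2.2‖]
  exact (Real.le_sqrt (norm_nonneg y) (sqNorm_nonneg y)).1 h

theorem sqNorm_le {E : Type*} [NormedAddCommGroup E] (y : State E) : sqNorm y ≤ 4 * ‖y‖ ^ 2 := by
  have hp := norm_fst_le y
  have hb := (norm_fst_le y.2).trans (norm_snd_le y)
  have hζ := (norm_fst_le y.2.2).trans ((norm_snd_le y.2).trans (norm_snd_le y))
  have hθ := (norm_snd_le y.2.2).trans ((norm_snd_le y.2).trans (norm_snd_le y))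
  unfold sqNorm
  have h := add_le_add (add_le_add (add_le_add (pow_le_pow_left₀ (norm_nonneg _) hp 2)
    (pow_le_pow_left₀ (norm_nonneg _) hb 2)) (pow_le_pow_left₀ (norm_nonneg _) hζ 2))
    (pow_le_pow_left₀ (norm_nonneg _) hθ 2)
  linarith

theorem opNorm_le_of_sqNorm_le {B : State H →L[ℝ] State H} {C : ℝ} (hC : 0 ≤ C)
    (hB : ∀ x, sqNorm (B x) ≤ C * sqNorm x) : ‖B‖ ≤ √(4 * C) := by
  refine B.opNorm_le_bound (Real.sqrt_nonneg _) fun x => le_of_sq_le_sq ?_ (by positivity)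
  calc ‖B x‖ ^ 2 ≤ C * sqNorm x := (norm_sq_le_sqNorm _).trans (hB x)
    _ ≤ C * (4 * ‖x‖ ^ 2) := mul_le_mul_of_nonneg_left (sqNorm_le x) hC
    _ = (√(4 * C) * ‖x‖) ^ 2 := by
      rw [mul_pow, Real.sq_sqrt (by positivity)]
      ring

/-- A curve in the state space that solves the system after multiplication by `A⁻¹ = S²`; this
makes sense for curves outside the domain of the generator. -/
structure IsRegularizedSolution (S : H →L[ℝ] H) (α γ μ κ η : ℝ) (y : ℝ → State H) : Prop where
  continuousOn : ContinuousOn y (Ici 0)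
  deriv : ∀ t, 0 ≤ t → HasDerivWithinAt (fun τ => diag (S * S) (y τ))
    (systemOp α γ μ κ η (S * S) S 1 (y t)) (Ici 0) t

theorem IsRegularizedSolution.isStrongSolution_sub {y z : ℝ → State H}
    (hy : IsRegularizedSolution S α γ μ κ η y) (hz : IsRegularizedSolution S α γ μ κ η z) :
    IsStrongSolution S α γ μ κ η (fun t => diag (S * S) (y t - z t)) := fun t ht =>
  ⟨_, _, _, _, flowsAt_of_hasDerivWithinAt rfl <| by
    simpa only [map_sub] using (hy.deriv t ht).fun_sub (hz.deriv t ht)⟩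

theorem IsRegularizedSolution.eqOn (hα : 0 < α) (hγ : 0 < γ) (hκ : 0 < κ)
    (hμ : 0 ≤ μ) (hcond : μ * (‖S‖ ^ 4 + κ ^ 2 / α ^ 2) < κ * η ^ 2)
    (hS : (S : H →ₗ[ℝ] H).IsSymmetric) (hinj : Function.Injective S) {y z : ℝ → State H}
    (hy : IsRegularizedSolution S α γ μ κ η y) (hz : IsRegularizedSolution S α γ μ κ η z)
    (h₀ : y 0 = z 0) : EqOn y z (Ici 0) := by
  intro t ht
  obtain ⟨M, ω, -, -, hdecay⟩ := exists_uniform_decay (H := H) hα hγ hκ hμ hcond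
  have hle := hdecay S hS le_rfl _ (hy.isStrongSolution_sub hz) t ht
  have hzero : ‖diag (S * S) (y t - z t)‖ ^ 2 ≤ 0 :=
    (norm_sq_le_sqNorm _).trans (hle.trans_eq (by simp [h₀, sqNorm]))
  have hdiag : diag (S * S) (y t - z t) = 0 := by
    simpa using le_antisymm hzero (sq_nonneg _)
  exact sub_eq_zero.1 (diag_injective (T := S * S) (hinj.comp hinj) (hdiag.trans (map_zero _).symm))

theorem commute_diag_cube_systemOp {R : H →L[ℝ] H} (h : Commute S R) :
    Commute (diag (S * S * S)) (systemOp α γ μ κ η 1 R (R * R)) := by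
  have hR : Commute (S * S * S) R := (h.mul_left h).mul_left h
  rw [commute_iff_eq, diag_mul_systemOp, systemOp_mul_diag, hR.eq, (hR.mul_right hR).eq, mul_one,
    one_mul]

variable [CompleteSpace H]

-- The nested product `State H` is too deep for the default setting.
set_option maxSynthPendingDepth 5

theorem isStrongSolution_exp {Q R : H →L[ℝ] H} (hQR : Q * R = 1) (x : State H) :
    IsStrongSolution Q α γ μ κ η
      (fun t => NormedSpace.exp (t • systemOp α γ μ κ η 1 R (R * R)) x) := by
  have hQQ : Q * Q * (R * R) = 1 := by rw [mul_assoc, ← mul_assoc Q R, hQR, one_mul, hQR]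
  have hQRR : Q * (R * R) = R := by rw [← mul_assoc, hQR, one_mul]
  refine fun t _ => ⟨_, _, _, _, flowsAt_of_hasDerivWithinAt
    (x := diag (R * R) (NormedSpace.exp (t • systemOp α γ μ κ η 1 R (R * R)) x)) ?_ ?_⟩
  · rw [← mul_apply_eq_comp, diag_mul_diag, hQQ]
    rfl
  · rw [← mul_apply_eq_comp, systemOp_mul_diag, hQQ, hQRR, one_mul]
    exact (hasDerivAt_exp_smul_apply _ x t).hasDerivWithinAt

theorem tendsto_systemOp_mul_diag_cube (hS : S.IsPositive) {ε : ℕ → ℝ} (hε : ∀ n, 0 < ε n)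
    (hε₀ : Tendsto ε atTop (𝓝 0)) :
    Tendsto (fun n => systemOp α γ μ κ η 1 (shiftInverse S (ε n))
        (shiftInverse S (ε n) * shiftInverse S (ε n)) * diag (S * S * S)) atTop
      (𝓝 (diag S * systemOp α γ μ κ η (S * S) S 1)) := by
  have hlim := (tendsto_const_nhds (x := S * S * S)).prodMk_nhds
    ((tendsto_shiftInverse_mul_cube hS hε hε₀).prodMk_nhds
      (tendsto_shiftInverse_sq_mul_cube hS hε hε₀))
  have hsys := ((continuous_systemOp (α := α) (γ := γ) (μ := μ) (κ := κ) (η := η)).tendsto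
    (S * S * S, S * S, S)).comp hlim
  rw [diag_mul_systemOp, mul_one, ← mul_assoc]
  refine hsys.congr fun n => ?_
  rw [Function.comp_apply, systemOp_mul_diag, one_mul]

theorem exists_isRegularizedSolution_of_tendsto (hS : S.IsPositive) (hinj : Function.Injective S)
    {ε : ℕ → ℝ} (hε : ∀ n, 0 < ε n) (hε₀ : Tendsto ε atTop (𝓝 0)) {G : ℕ → State H →L[ℝ] State H}
    (hG : ∀ n, G n = systemOp α γ μ κ η 1 (shiftInverse S (ε n))
      (shiftInverse S (ε n) * shiftInverse S (ε n)))
    {K : ℝ} (hK : ∀ n (t : ℝ), 0 ≤ t → ‖NormedSpace.exp (t • G n)‖ ≤ K) (x : State H) :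
    ∃ y, IsRegularizedSolution S α γ μ κ η y ∧
      ∀ t, 0 ≤ t → Tendsto (fun n => NormedSpace.exp (t • G n) x) atTop (𝓝 (y t)) := by
  have hcomm (n : ℕ) : Commute (diag (S * S * S)) (G n) :=
    hG n ▸ commute_diag_cube_systemOp commute_shiftInverse
  have hdense : DenseRange (diag (S * S * S)) := by
    have h := denseRange_of_isSymmetric_of_injective hS.isSymmetric hinj
    exact denseRange_diag ((h.comp h S.continuous).comp h (S * S).continuous)
  have hlim : Tendsto (fun n => G n * diag (S * S * S)) atTop
      (𝓝 (diag S * systemOp α γ μ κ η (S * S) S 1)) := by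
    simpa only [hG] using tendsto_systemOp_mul_diag_cube hS hε hε₀
  obtain ⟨y, hyc, hy⟩ := exists_tendsto_exp_smul_apply hK hcomm hdense hlim x
  refine ⟨y, ⟨hyc, fun t ht => ?_⟩, hy⟩
  refine hasDerivWithinAt_of_injective (diag_injective hinj)
    (f' := fun τ => systemOp α γ μ κ η (S * S) S 1 (y τ))
    ((systemOp α γ μ κ η (S * S) S 1).continuous.comp_continuousOn hyc) (fun τ hτ => ?_) ht
  exact hasDerivWithinAt_of_tendsto_exp_smul_apply hK hcomm hlim hyc hy hτ

theorem exists_decaying_regularizedSolutions (hα : 0 < α) (hγ : 0 < γ) (hκ : 0 < κ)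
    (hμ : 0 ≤ μ) (hcond : μ * (s ^ 4 + κ ^ 2 / α ^ 2) < κ * η ^ 2) (hS : S.IsPositive)
    (hinj : Function.Injective S) (hSs : ‖S‖ < s) :
    ∃ M ω : ℝ, 0 < M ∧ 0 < ω ∧ ∀ x, ∃ y, y 0 = x ∧ IsRegularizedSolution S α γ μ κ η y ∧
      ∀ t, 0 ≤ t → sqNorm (y t) ≤ M * sqNorm x * Real.exp (-ω * t) := by
  obtain ⟨M, ω, hM, hω, hdecay⟩ := exists_uniform_decay (H := H) hα hγ hκ hμ hcond
  refine ⟨M, ω, hM, hω, fun x => ?_⟩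
  obtain ⟨ε, -, hε, hε₀⟩ := exists_seq_strictAnti_tendsto' (sub_pos.2 hSs)
  set G := fun n => systemOp α γ μ κ η 1 (shiftInverse S (ε n))
    (shiftInverse S (ε n) * shiftInverse S (ε n))
  have hdecay_exp (n : ℕ) (z : State H) {t : ℝ} (ht : 0 ≤ t) :
      sqNorm (NormedSpace.exp (t • G n) z) ≤ M * sqNorm z * Real.exp (-ω * t) := by
    have hnorm : ‖S + ε n • (1 : H →L[ℝ] H)‖ ≤ s := by
      refine (norm_add_le_of_le le_rfl ?_).trans (add_le_of_le_sub_left (hε n).2.le)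
      rw [norm_smul, Real.norm_of_nonneg (hε n).1.le]
      exact mul_le_of_le_one_right (hε n).1.le ContinuousLinearMap.norm_id_le
    have hsymm : ((S + ε n • (1 : H →L[ℝ] H) : H →L[ℝ] H) : H →ₗ[ℝ] H).IsSymmetric :=
      hS.isSymmetric.add (LinearMap.IsSymmetric.id.smul (by simp))
    simpa using hdecay _ hsymm hnorm _
      (isStrongSolution_exp (add_smul_one_mul_shiftInverse hS (hε n).1) z) t ht
  have hK (n : ℕ) (t : ℝ) (ht : 0 ≤ t) : ‖NormedSpace.exp (t • G n)‖ ≤ √(4 * M) := by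
    refine opNorm_le_of_sqNorm_le hM.le fun z => (hdecay_exp n z ht).trans ?_
    exact mul_le_of_le_one_right (mul_nonneg hM.le (sqNorm_nonneg z))
      (Real.exp_le_one_iff.2 (by nlinarith))
  obtain ⟨y, hy, hlim⟩ := exists_isRegularizedSolution_of_tendsto hS hinj (fun n => (hε n).1) hε₀
    (fun _ => rfl) hK x
  refine ⟨y, tendsto_nhds_unique (hlim 0 le_rfl) (by simp), hy, fun t ht => ?_⟩
  have hcont : Continuous (sqNorm (H := H)) := by unfold sqNorm; fun_prop
  exact le_of_tendsto ((hcont.tendsto _).comp (hlim t ht))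
    (Eventually.of_forall fun n => hdecay_exp n x ht)

end Regularized

/-! ### The bottom of the spectrum -/

section Spectrum

variable [CompleteSpace H] {A : H →ₗ.[ℝ] H}

theorem exists_larger_lower_bound (hA : IsSelfAdjoint A) {z : ℝ}
    (hz : ∀ x : A.domain, z * ‖(x : H)‖ ^ 2 ≤ ⟪A x, (x : H)⟫_ℝ) (hres : InResolventSet A z) :
    ∃ δ > 0, ∀ x : A.domain, (z + δ) * ‖(x : H)‖ ^ 2 ≤ ⟪A x, (x : H)⟫_ℝ := by
  obtain ⟨B, hright, hleft⟩ := hres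
  choose hdom hright using hright
  have hAB (y : H) : A ⟨B y, hdom y⟩ = y + z • B y := sub_eq_iff_eq_add.1 (hright y)
  have hnonneg (y : H) : 0 ≤ ⟪y, B y⟫_ℝ := by
    have h := hz ⟨B y, hdom y⟩
    rw [hAB, inner_add_left, real_inner_smul_left, real_inner_self_eq_norm_sq] at h
    linarith
  have hsymm (x y : H) : ⟪B x, y⟫_ℝ = ⟪x, B y⟫_ℝ := by
    have h := graph_symm hA (A.mem_graph ⟨B x, hdom x⟩) (A.mem_graph ⟨B y, hdom y⟩)
    rw [hAB, hAB, inner_add_left, inner_add_right, real_inner_smul_left,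
      real_inner_smul_right] at h
    linarith
  set K := ‖B‖ + 1 with hK
  have hK₀ : 0 < K := by positivity
  refine ⟨K⁻¹, inv_pos.2 hK₀, fun x => ?_⟩
  -- Positivity of `B` at `y - K⁻¹ B y` gives `‖B y‖² ≤ K ⟪y, B y⟫`; take `y = (A - z) x`.
  have hkey (y : H) : K⁻¹ * ‖B y‖ ^ 2 ≤ ⟪y, B y⟫_ℝ := by
    have hBB : ⟪B y, B (B y)⟫_ℝ ≤ K * ‖B y‖ ^ 2 := by
      refine (real_inner_le_norm _ _).trans ?_
      have h := mul_le_mul_of_nonneg_left (B.le_opNorm (B y)) (norm_nonneg (B y))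
      rw [hK]
      linarith [sq_nonneg ‖B y‖]
    have hpos := hnonneg (y - K⁻¹ • B y)
    simp only [map_sub, map_smul, inner_sub_left, inner_sub_right, real_inner_smul_left,
      real_inner_smul_right, ← hsymm y (B y), real_inner_self_eq_norm_sq] at hpos
    have h := mul_le_mul_of_nonneg_left hBB (mul_pos (inv_pos.2 hK₀) (inv_pos.2 hK₀)).le
    have hcancel : K⁻¹ * K⁻¹ * (K * ‖B y‖ ^ 2) = K⁻¹ * ‖B y‖ ^ 2 := by field_simp
    linarith
  have h := hkey (A x - z • (x : H))
  rw [hleft, inner_sub_left, real_inner_smul_left, real_inner_self_eq_norm_sq] at h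
  linarith

theorem lower_bound_of_forall_inResolventSet (hA : IsSelfAdjoint A) {c lam : ℝ}
    (hc : ∀ x : A.domain, c * ‖(x : H)‖ ^ 2 ≤ ⟪A x, (x : H)⟫_ℝ)
    (hres : ∀ z < lam, InResolventSet A z) (x : A.domain) :
    lam * ‖(x : H)‖ ^ 2 ≤ ⟪A x, (x : H)⟫_ℝ := by
  set Z : Set ℝ := Iic lam ∩ ⋂ x : A.domain, {z | z * ‖(x : H)‖ ^ 2 ≤ ⟪A x, (x : H)⟫_ℝ} with hZ
  have hmem {z : ℝ} : z ∈ Z ↔ z ≤ lam ∧ ∀ x : A.domain, z * ‖(x : H)‖ ^ 2 ≤ ⟪A x, (x : H)⟫_ℝ := by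
    simp only [hZ, mem_inter_iff, mem_Iic, mem_iInter, mem_ofPred_eq]
  have hmin {z : ℝ} (hz : ∀ x : A.domain, z * ‖(x : H)‖ ^ 2 ≤ ⟪A x, (x : H)⟫_ℝ) :
      min z lam ∈ Z := hmem.2 ⟨min_le_right _ _, fun x =>
    (mul_le_mul_of_nonneg_right (min_le_left _ _) (sq_nonneg _)).trans (hz x)⟩
  have hbdd : BddAbove Z := ⟨lam, fun z hz => hz.1⟩
  have hclosed : IsClosed Z :=
    isClosed_Iic.inter (isClosed_iInter fun x => isClosed_le (by fun_prop) continuous_const)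
  obtain ⟨hle, hsup⟩ := hmem.1 (hclosed.csSup_mem ⟨_, hmin hc⟩ hbdd)
  obtain h | h := hle.eq_or_lt
  · exact h ▸ hsup x
  · obtain ⟨δ, hδ, hlarger⟩ := exists_larger_lower_bound hA hsup (hres _ h)
    obtain h' | h' := min_le_iff.1 (le_csSup hbdd (hmin hlarger)) <;> linarith

/-- The bounded operator `S` is `A^{-1/2}`. -/
structure IsInvSqrt (S : H →L[ℝ] H) (A : H →ₗ.[ℝ] H) : Prop where
  isPositive : S.IsPositive
  mem_graph_posSqrt_iff : ∀ x y, (x, y) ∈ (posSqrt A).graph ↔ x = S y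
  mem_graph_iff : ∀ x y, (x, y) ∈ A.graph ↔ x = S (S y)

theorem exists_isInvSqrt (hA : IsSelfAdjoint A) {c : ℝ} (hc : 0 < c)
    (hpos : ∀ x : A.domain, c * ‖(x : H)‖ ^ 2 ≤ ⟪A x, (x : H)⟫_ℝ) :
    ∃ S, IsInvSqrt S A := by
  obtain ⟨hR, hRpos, hRA⟩ := isPosSqrt_posSqrt hA ⟨c, hc, hpos⟩
  have hinj (x : H) (hx : (x, (0 : H)) ∈ (posSqrt A).graph) : x = 0 := by
    obtain ⟨x, rfl, hAx⟩ := (LinearPMap.mem_graph_iff A).1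
      ((hRA x 0).2 ⟨0, hx, (posSqrt A).graph.zero_mem⟩)
    have h := hpos x
    rw [show A x = 0 from hAx, inner_zero_left] at h
    simpa using nonpos_of_mul_nonpos_right h hc
  have hsurj (y : H) : ∃ x, (x, y) ∈ (posSqrt A).graph := by
    obtain ⟨x, hx⟩ := surjective_of_strictlyPositive hA hc hpos y
    obtain ⟨z, -, hz⟩ := (hRA x y).1 hx
    exact ⟨z, hz⟩
  obtain ⟨S, hS, hSR⟩ := exists_inverse hR hinj hsurj
  refine ⟨S, ⟨hS.isSymmetric, fun y => ?_⟩, hSR, fun x y => (hRA x y).trans ⟨?_, ?_⟩⟩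
  · obtain ⟨x, hx, hy⟩ := (LinearPMap.mem_graph_iff _).1 ((hSR _ y).2 rfl)
    have h := hRpos x
    rwa [show (x : H) = S y from hx, show posSqrt A x = y from hy, real_inner_comm] at h
  · rintro ⟨z, hxz, hzy⟩
    rw [(hSR _ _).1 hxz, (hSR _ _).1 hzy]
  · rintro rfl
    exact ⟨S y, (hSR _ _).2 rfl, (hSR _ _).2 rfl⟩

namespace IsInvSqrt

variable {S : H →L[ℝ] H}

theorem injective (hS : IsInvSqrt S A) : Function.Injective S :=
  (injective_iff_map_eq_zero S).2 fun y hy =>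
    LinearPMap.graph_fst_eq_zero_snd _ ((hS.mem_graph_posSqrt_iff _ y).2 rfl) hy

theorem apply_apply (hS : IsInvSqrt S A) (x : A.domain) : S (S (A x)) = x :=
  ((hS.mem_graph_iff _ _).1 (A.mem_graph x)).symm

theorem exists_domain_eq (hS : IsInvSqrt S A) (ψ : H) :
    ∃ φ : A.domain, (φ : H) = S (S ψ) ∧ A φ = ψ :=
  (LinearPMap.mem_graph_iff A).1 ((hS.mem_graph_iff _ ψ).2 rfl)

theorem sq_norm_le (hS : IsInvSqrt S A) {lam : ℝ} (hlam : 0 < lam)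
    (hA : ∀ x : A.domain, lam * ‖(x : H)‖ ^ 2 ≤ ⟪A x, (x : H)⟫_ℝ) : ‖S‖ ^ 2 ≤ 1 / lam := by
  rw [← hS.isPositive.isSelfAdjoint.norm_mul_self]
  refine (S * S).opNorm_le_bound (by positivity) fun x => ?_
  obtain ⟨φ, hφ, hAφ⟩ := hS.exists_domain_eq x
  have h := (hA φ).trans (real_inner_le_norm _ _)
  rw [hφ, hAφ] at h
  rw [one_div_mul_eq_div, le_div_iff₀' hlam]
  change lam * ‖S (S x)‖ ≤ ‖x‖
  obtain h₀ | h₀ := (norm_nonneg (S (S x))).eq_or_lt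
  · simp [← h₀]
  · exact le_of_mul_le_mul_right (by linarith) h₀

theorem inResolventSet_of_nonpos (hS : IsInvSqrt S A) {z : ℝ} (hz : z ≤ 0) :
    InResolventSet A z := by
  have hpos : ((-z) • (S * S)).IsPositive := by
    have h := ContinuousLinearMap.isPositive_adjoint_comp_self S
    rw [hS.isPositive.isSelfAdjoint.adjoint_eq] at h
    exact h.smul_of_nonneg (neg_nonneg.2 hz)
  have hunit := isUnit_add_smul_one hpos one_pos
  set R := shiftInverse ((-z) • (S * S)) 1
  have hright (y : H) : R y - z • S (S (R y)) = y := by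
    have h : (-z) • S (S (R y)) + (1 : ℝ) • R y = y :=
      DFunLike.congr_fun (Ring.mul_inverse_cancel _ hunit) y
    rwa [one_smul, neg_smul, neg_add_eq_sub] at h
  have hleft (y : H) : R (y - z • S (S y)) = y := by
    have h : R ((-z) • S (S y) + (1 : ℝ) • y) = y :=
      DFunLike.congr_fun (Ring.inverse_mul_cancel _ hunit) y
    rwa [one_smul, neg_smul, neg_add_eq_sub] at h
  refine ⟨S * S * R, fun y => ?_, fun x => ?_⟩
  · obtain ⟨φ, hφ, hAφ⟩ := hS.exists_domain_eq (R y)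
    have hmem : S (S (R y)) ∈ A.domain := hφ ▸ φ.2
    refine ⟨hmem, ?_⟩
    rw [show (⟨(S * S * R) y, hmem⟩ : A.domain) = φ from Subtype.ext hφ.symm, hAφ]
    exact hright y
  · calc S (S (R (A x - z • (x : H)))) = S (S (R (A x - z • S (S (A x))))) := by
          rw [hS.apply_apply]
      _ = x := by rw [hleft, hS.apply_apply]

end IsInvSqrt

theorem pos_and_lower_bound_of_isLeast_spectrumSet (hA : IsSelfAdjoint A)
    (hpos : ∃ c > 0, ∀ x : A.domain, c * ‖(x : H)‖ ^ 2 ≤ ⟪A x, (x : H)⟫_ℝ) {lam : ℝ}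
    (hlam : IsLeast (spectrumSet A) lam) :
    0 < lam ∧ ∀ x : A.domain, lam * ‖(x : H)‖ ^ 2 ≤ ⟪A x, (x : H)⟫_ℝ := by
  obtain ⟨c, hc, hcA⟩ := hpos
  obtain ⟨S, hS⟩ := exists_isInvSqrt hA hc hcA
  exact ⟨not_le.1 fun h => hlam.1 (hS.inResolventSet_of_nonpos h),
    lower_bound_of_forall_inResolventSet hA hcA fun z hz =>
      not_not.1 fun h => hz.not_ge (hlam.2 h)⟩

end Spectrum

theorem inv_sq_add_sq_le_mul_threshold {α κ lam : ℝ} (hα : 0 < α) (hκ : 0 < κ) (hlam : 0 < lam) :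
    1 / lam ^ 2 + κ ^ 2 / α ^ 2 ≤ κ * threshold α lam κ := by
  unfold threshold
  split_ifs with hlt
  · have h : κ * (2 * κ / α ^ 2 * (1 - α / (κ * lam) + α ^ 2 / (κ ^ 2 * lam ^ 2)))
        = 1 / lam ^ 2 + κ ^ 2 / α ^ 2 + (1 / lam - κ / α) ^ 2 := by
      field_simp
      ring
    rw [h]
    exact le_add_of_nonneg_right (sq_nonneg _)
  · have hle : 1 / lam ≤ κ / α := by
      rw [div_le_div_iff₀ hlam hα, one_mul]
      exact (div_le_iff₀ hlam).1 (not_lt.1 hlt)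
    calc 1 / lam ^ 2 + κ ^ 2 / α ^ 2 = (1 / lam) ^ 2 + κ ^ 2 / α ^ 2 := by ring
      _ ≤ (κ / α) ^ 2 + κ ^ 2 / α ^ 2 := by gcongr
      _ = κ * (2 * κ / α ^ 2) := by ring

theorem mul_inv_sq_add_sq_lt_of_threshold_mul_lt {α κ lam μ η : ℝ} (hα : 0 < α) (hκ : 0 < κ)
    (hlam : 0 < lam) (hμ : 0 ≤ μ) (hη : threshold α lam κ * μ < η ^ 2) :
    μ * (1 / lam ^ 2 + κ ^ 2 / α ^ 2) < κ * η ^ 2 :=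
  calc μ * (1 / lam ^ 2 + κ ^ 2 / α ^ 2) ≤ μ * (κ * threshold α lam κ) :=
        mul_le_mul_of_nonneg_left (inv_sq_add_sq_le_mul_threshold hα hκ hlam) hμ
    _ = κ * (threshold α lam κ * μ) := by ring
    _ < κ * η ^ 2 := mul_lt_mul_of_pos_left hη hκ

/-! ### Weak solutions in the coordinates of the state space -/

section Coordinates

variable [CompleteSpace H] {A : H →ₗ.[ℝ] H} {S : H →L[ℝ] H} {α β γ κ η : ℝ}

/-- The coordinates `(A^{1/2}(v + α u), A^{1/2} v, w + α v, θ)` of a point of the phase space. -/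
noncomputable def toState (α : ℝ) (U : PhaseSpace A) : State H :=
  (posSqrt A (U.v + α • U.u), posSqrt A U.v, U.w + α • (U.v : H), U.θ)

theorem energy_eq_sqNorm_toState (U : PhaseSpace A) :
    energy A α U = 1 / 2 * sqNorm (toState α U) := by
  simp only [energy, toState, sqNorm]
  ring

namespace IsInvSqrt

theorem mem_domain_posSqrt (hS : IsInvSqrt S A) (y : H) : S y ∈ (posSqrt A).domain :=
  LinearPMap.mem_domain_of_mem_graph ((hS.mem_graph_posSqrt_iff _ y).2 rfl)

theorem apply_posSqrt (hS : IsInvSqrt S A) (x : (posSqrt A).domain) : S (posSqrt A x) = x :=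
  ((hS.mem_graph_posSqrt_iff _ _).1 ((posSqrt A).mem_graph x)).symm

theorem posSqrt_apply (hS : IsInvSqrt S A) (y : H) :
    posSqrt A ⟨S y, hS.mem_domain_posSqrt y⟩ = y :=
  hS.injective (hS.apply_posSqrt _)

/-- The point of the phase space with given coordinates, inverse to `toState α` for `α ≠ 0`. -/
noncomputable def ofState (hS : IsInvSqrt S A) (α : ℝ) (y : State H) : PhaseSpace A where
  u := ⟨S (α⁻¹ • (y.1 - y.2.1)), hS.mem_domain_posSqrt _⟩
  v := ⟨S y.2.1, hS.mem_domain_posSqrt _⟩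
  w := y.2.2.1 - α • S y.2.1
  θ := y.2.2.2

theorem ofState_toState (hS : IsInvSqrt S A) (hα : α ≠ 0) (U : PhaseSpace A) :
    hS.ofState α (toState α U) = U := by
  have hu : α⁻¹ • (posSqrt A (U.v + α • U.u) - posSqrt A U.v) = posSqrt A U.u := by
    rw [LinearPMap.map_add, LinearPMap.map_smul, add_sub_cancel_left, inv_smul_smul₀ hα]
  obtain ⟨u, v, w, θ⟩ := U
  simp only [ofState, toState, hu, hS.apply_posSqrt, add_sub_cancel_right]

theorem toState_ofState (hS : IsInvSqrt S A) (hα : α ≠ 0) (y : State H) :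
    toState α (hS.ofState α y) = y := by
  simp only [toState, ofState, LinearPMap.map_add, LinearPMap.map_smul, hS.posSqrt_apply,
    smul_inv_smul₀ hα, add_sub_cancel, sub_add_cancel]

theorem inner_apply_apply (hS : IsInvSqrt S A) (x : H) (φ : A.domain) :
    ⟪S (S x), A φ⟫_ℝ = ⟪x, (φ : H)⟫_ℝ := by
  have hsymm (a b : H) : ⟪S a, b⟫_ℝ = ⟪a, S b⟫_ℝ := hS.isPositive.isSymmetric a b
  rw [hsymm, hsymm, hS.apply_apply]

theorem hasDerivWithinAt_inner (hS : IsInvSqrt S A) {f : ℝ → H} {f' : H} {I : Set ℝ} {t : ℝ}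
    (hf : HasDerivWithinAt (fun τ => S (S (f τ))) f' I t) (φ : A.domain) :
    HasDerivWithinAt (fun τ => ⟪f τ, (φ : H)⟫_ℝ) ⟪f', A φ⟫_ℝ I t := by
  simpa only [hS.inner_apply_apply, inner_zero_right, zero_add] using
    hf.inner ℝ (hasDerivWithinAt_const t I (A φ))

theorem hasDerivWithinAt_of_inner (hS : IsInvSqrt S A) {f f' : ℝ → H}
    (hf' : ContinuousOn f' (Ici 0))
    (hf : ∀ φ : A.domain, ∀ t, 0 ≤ t →
      HasDerivWithinAt (fun τ => ⟪f τ, (φ : H)⟫_ℝ) ⟪f' t, A φ⟫_ℝ (Ici 0) t) {t : ℝ} (ht : 0 ≤ t) :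
    HasDerivWithinAt (fun τ => S (S (f τ))) (f' t) (Ici 0) t := by
  refine hasDerivWithinAt_of_separating (L := fun ψ : H => innerSL ℝ ψ)
    (fun x hx => inner_self_eq_zero.1 (hx x)) hf' (fun ψ τ hτ => ?_) ht
  obtain ⟨φ, -, rfl⟩ := hS.exists_domain_eq ψ
  simpa only [innerSL_apply_apply, real_inner_comm (A φ), ← hS.inner_apply_apply] using hf φ τ hτ

end IsInvSqrt

namespace IsWeakSolution

variable {U : ℝ → PhaseSpace A}

theorem continuousOn_coe_u (hU : IsWeakSolution A α β γ κ η U) :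
    ContinuousOn (fun t => ((U t).u : H)) (Ici 0) := fun t ht =>
  (hU.deriv_u t ht).continuousWithinAt

theorem continuousOn_coe_v (hU : IsWeakSolution A α β γ κ η U) :
    ContinuousOn (fun t => ((U t).v : H)) (Ici 0) := fun t ht =>
  (hU.deriv_v t ht).continuousWithinAt

theorem continuousOn_toState (hU : IsWeakSolution A α β γ κ η U) :
    ContinuousOn (fun t => toState α (U t)) (Ici 0) := by
  simp only [toState, LinearPMap.map_add, LinearPMap.map_smul]
  exact (hU.continuousOn_v.add (hU.continuousOn_u.const_smul α)).prodMk
    (hU.continuousOn_v.prodMk ((hU.continuousOn_w.add (hU.continuousOn_coe_v.const_smul α)).prodMk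
      hU.continuousOn_θ))

theorem hasDerivWithinAt_apply_apply_w_add (hS : IsInvSqrt S A)
    (hU : IsWeakSolution A α β γ κ η U) {t : ℝ} (ht : 0 ≤ t) :
    HasDerivWithinAt (fun τ => S (S ((U τ).w + α • ((U τ).v : H))))
      (η • (U t).θ - γ • ((U t).u : H) - β • ((U t).v : H)) (Ici 0) t := by
  refine hS.hasDerivWithinAt_of_inner
    (f' := fun τ => η • (U τ).θ - γ • ((U τ).u : H) - β • ((U τ).v : H))
    (((hU.continuousOn_θ.const_smul η).sub (hU.continuousOn_coe_u.const_smul γ)).sub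
      (hU.continuousOn_coe_v.const_smul β)) (fun φ τ hτ => ?_) ht
  have h := (hU.deriv_w φ τ hτ).add
    (((hU.deriv_v τ hτ).inner ℝ (hasDerivWithinAt_const τ _ (φ : H))).const_mul α)
  refine (h.congr_of_mem (fun σ _ => ?_) hτ).congr_deriv ?_
  · simp only [inner_add_left, real_inner_smul_left, Pi.add_apply]
  · simp only [inner_sub_left, real_inner_smul_left, inner_zero_right]
    ring

theorem hasDerivWithinAt_apply_apply_θ (hS : IsInvSqrt S A)
    (hU : IsWeakSolution A α β γ κ η U) {t : ℝ} (ht : 0 ≤ t) :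
    HasDerivWithinAt (fun τ => S (S (U τ).θ))
      (-(κ • (U t).θ) - η • ((U t).w + α • ((U t).v : H))) (Ici 0) t := by
  refine hS.hasDerivWithinAt_of_inner
    (f' := fun τ => -(κ • (U τ).θ) - η • ((U τ).w + α • ((U τ).v : H)))
    ((hU.continuousOn_θ.const_smul κ).neg.sub
      ((hU.continuousOn_w.add (hU.continuousOn_coe_v.const_smul α)).const_smul η))
    (fun φ τ hτ => (hU.deriv_θ φ τ hτ).congr_deriv ?_) ht
  simp only [inner_add_left, inner_sub_left, inner_neg_left, real_inner_smul_left]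
  ring

theorem isRegularizedSolution (hS : IsInvSqrt S A) (hα : α ≠ 0)
    (hU : IsWeakSolution A α β γ κ η U) :
    IsRegularizedSolution S α γ (γ - α * β) κ η (fun t => toState α (U t)) := by
  refine ⟨hU.continuousOn_toState, fun t ht => ?_⟩
  have hp := S.hasFDerivAt.comp_hasDerivWithinAt t
    ((hU.deriv_v t ht).fun_add ((hU.deriv_u t ht).fun_const_smul α))
  have hb := S.hasFDerivAt.comp_hasDerivWithinAt t (hU.deriv_v t ht)
  have hderiv := hp.prodMk (hb.prodMk ((hU.hasDerivWithinAt_apply_apply_w_add hS ht).prodMk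
    (hU.hasDerivWithinAt_apply_apply_θ hS ht)))
  refine (hderiv.congr_of_mem (fun τ _ => ?_) ht).congr_deriv ?_
  · simp only [diag_apply, toState, mul_apply_eq_comp, hS.apply_posSqrt, Function.comp_apply]
    rfl
  · have hSp : S (posSqrt A ((U t).v + α • (U t).u)) = (U t).v + α • ((U t).u : H) :=
      hS.apply_posSqrt _
    simp only [systemOp_apply, toState, mul_apply_eq_comp, one_apply_eq_self, hSp,
      hS.apply_posSqrt, map_add, map_smul, add_sub_cancel_right]
    refine Prod.ext rfl (Prod.ext rfl (Prod.ext ?_ rfl))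
    match_scalars <;> field_simp
    ring

end IsWeakSolution

theorem IsRegularizedSolution.isWeakSolution (hS : IsInvSqrt S A) (hα : α ≠ 0) {y : ℝ → State H}
    (hy : IsRegularizedSolution S α γ (γ - α * β) κ η y) :
    IsWeakSolution A α β γ κ η (fun t => hS.ofState α (y t)) := by
  have hp : ContinuousOn (fun t => (y t).1) (Ici 0) := hy.continuousOn.fst
  have hb : ContinuousOn (fun t => (y t).2.1) (Ici 0) := hy.continuousOn.snd.fst
  have hζ : ContinuousOn (fun t => (y t).2.2.1) (Ici 0) := hy.continuousOn.snd.snd.fst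
  have hw : ContinuousOn (fun t => (y t).2.2.1 - α • S (y t).2.1) (Ici 0) :=
    hζ.sub ((S.continuous.comp_continuousOn hb).const_smul α)
  have hd (t : ℝ) (ht : 0 ≤ t) := hy.deriv t ht
  simp only [systemOp_apply, diag_apply, mul_apply_eq_comp, one_apply_eq_self] at hd
  have hp' (t : ℝ) (ht : 0 ≤ t) : HasDerivWithinAt (fun τ => S (y τ).1) (y t).2.2.1 (Ici 0) t :=
    hasDerivWithinAt_of_injective hS.injective hζ (fun τ hτ => hasDerivWithinAt_fst (hd τ hτ)) ht
  have hb' (t : ℝ) (ht : 0 ≤ t) : HasDerivWithinAt (fun τ => S (y τ).2.1)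
      ((y t).2.2.1 - α • S (y t).2.1) (Ici 0) t :=
    hasDerivWithinAt_of_injective hS.injective hw (fun τ hτ => by
      simpa only [map_sub, map_smul] using hasDerivWithinAt_fst (hasDerivWithinAt_snd (hd τ hτ))) ht
  refine ⟨?_, ?_, hw, hy.continuousOn.snd.snd.snd, fun t ht => ?_, hb', fun φ t ht => ?_,
    fun φ t ht => ?_⟩
  · simpa only [IsInvSqrt.ofState, hS.posSqrt_apply] using (hp.fun_sub hb).fun_const_smul α⁻¹
  · simpa only [IsInvSqrt.ofState, hS.posSqrt_apply] using hb
  · simpa only [IsInvSqrt.ofState, map_smul, map_sub, sub_sub_cancel, inv_smul_smul₀ hα] using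
      ((hp' t ht).fun_sub (hb' t ht)).fun_const_smul α⁻¹
  · have h := (hS.hasDerivWithinAt_inner (hasDerivWithinAt_fst (hasDerivWithinAt_snd
      (hasDerivWithinAt_snd (hd t ht)))) φ).sub
      (((hb' t ht).inner ℝ (hasDerivWithinAt_const t _ (φ : H))).const_mul α)
    refine (h.congr_of_mem (fun τ _ => ?_) ht).congr_deriv ?_
    · simp only [IsInvSqrt.ofState, inner_sub_left, real_inner_smul_left, Pi.sub_apply]
    · simp only [IsInvSqrt.ofState, map_smul, map_sub, inner_sub_left, inner_add_left,
        real_inner_smul_left, inner_zero_right]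
      field_simp
      ring
  · refine (hS.hasDerivWithinAt_inner (hasDerivWithinAt_snd (hasDerivWithinAt_snd
      (hasDerivWithinAt_snd (hd t ht)))) φ).congr_deriv ?_
    simp only [IsInvSqrt.ofState, inner_sub_left, inner_neg_left, real_inner_smul_left]
    ring

theorem exists_gt_mul_pow_add_lt {a r b c : ℝ} {n : ℕ} (h : a * (r ^ n + b) < c) :
    ∃ s > r, a * (s ^ n + b) < c := by
  have hcont : Continuous fun s : ℝ => a * (s ^ n + b) := by fun_prop
  exact ((hcont.tendsto r).eventually_lt_const h).exists_gt

theorem IsInvSqrt.exponentiallyStable (hS : IsInvSqrt S A) (hα : 0 < α) (hγ : 0 < γ) (hκ : 0 < κ)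
    (hμ : 0 ≤ γ - α * β) (hcond : (γ - α * β) * (‖S‖ ^ 4 + κ ^ 2 / α ^ 2) < κ * η ^ 2) :
    ExponentiallyStable A α β γ κ η := by
  obtain ⟨s, hSs, hs⟩ := exists_gt_mul_pow_add_lt hcond
  obtain ⟨M, ω, -, hω, hsol⟩ :=
    exists_decaying_regularizedSolutions hα hγ hκ hμ hs hS.isPositive hS.injective hSs
  choose y hy₀ hy hdecay using hsol
  refine ⟨fun t U₀ => hS.ofState α (y (toState α U₀) t), ⟨fun U₀ => ?_,
    fun U₀ => (hy _).isWeakSolution hS hα.ne', fun U hU t ht => ?_⟩, max 1 M, ω,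
    le_max_left _ _, hω, fun U₀ t ht => ?_⟩
  · rw [hy₀, hS.ofState_toState hα.ne']
  · have heq := (hU.isRegularizedSolution hS hα.ne').eqOn hα hγ hκ hμ hcond
      hS.isPositive.isSymmetric hS.injective (hy (toState α (U 0))) (hy₀ _).symm
    exact heq ht ▸ (hS.ofState_toState hα.ne' (U t)).symm
  · rw [energy_eq_sqNorm_toState, energy_eq_sqNorm_toState, hS.toState_ofState hα.ne']
    have hM : M * sqNorm (toState α U₀) * Real.exp (-ω * t) ≤
        max 1 M * sqNorm (toState α U₀) * Real.exp (-ω * t) := by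
      gcongr
      exacts [sqNorm_nonneg _, le_max_right _ _]
    linarith [hdecay (toState α U₀) t ht]

end Coordinates

end MGTFourier

theorem theorem6p3_general {H : Type*} [NormedAddCommGroup H] [InnerProductSpace ℝ H]
    [CompleteSpace H] (A : H →ₗ.[ℝ] H) (hA : IsSelfAdjoint A) {lam : ℝ} (hlam : 0 < lam)
    (hlamA : ∀ x : A.domain, lam * ‖(x : H)‖ ^ 2 ≤ inner ℝ (A x) (x : H))
    {α β γ κ η : ℝ} (hα : 0 < α) (hγ : 0 < γ) (hκ : 0 < κ) (hμ : 0 ≤ γ - α * β)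
    (hcond : (γ - α * β) * (1 / lam ^ 2 + κ ^ 2 / α ^ 2) < κ * η ^ 2) :
    MGTFourier.ExponentiallyStable A α β γ κ η := by
  obtain ⟨S, hS⟩ := MGTFourier.exists_isInvSqrt hA hlam hlamA
  refine hS.exponentiallyStable hα hγ hκ hμ (lt_of_le_of_lt ?_ hcond)
  gcongr
  calc ‖S‖ ^ 4 = (‖S‖ ^ 2) ^ 2 := by ring
    _ ≤ (1 / lam) ^ 2 := pow_le_pow_left₀ (sq_nonneg _) (hS.sq_norm_le hlam hlamA) 2
    _ = 1 / lam ^ 2 := by ring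

theorem theorem6p3 {H : Type*} [NormedAddCommGroup H] [InnerProductSpace ℝ H] [CompleteSpace H]
    (A : H →ₗ.[ℝ] H) (hA : IsSelfAdjoint A)
    (hpos : ∃ c > 0, ∀ x : A.domain, c * ‖(x : H)‖ ^ 2 ≤ inner ℝ (A x) (x : H))
    (lam₁ : ℝ) (hlam₁ : IsLeast (MGTFourier.spectrumSet A) lam₁)
    (α β γ κ η : ℝ) (hα : 0 < α) (hβ : 0 < β) (hγ : 0 < γ) (hκ : 0 < κ)
    (hμ : 0 ≤ γ - α * β) :
    (MGTFourier.threshold α lam₁ κ * (γ - α * β) < η ^ 2 →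
      MGTFourier.ExponentiallyStable A α β γ κ η) ∧
    (γ - α * β = 0 → η ≠ 0 → MGTFourier.ExponentiallyStable A α β γ κ η) := by
  obtain ⟨hlam, hlamA⟩ := MGTFourier.pos_and_lower_bound_of_isLeast_spectrumSet hA hpos hlam₁
  have hstable (hη : MGTFourier.threshold α lam₁ κ * (γ - α * β) < η ^ 2) :=
    theorem6p3_general A hA hlam hlamA hα hγ hκ hμ
      (MGTFourier.mul_inv_sq_add_sq_lt_of_threshold_mul_lt hα hκ hlam hμ hη)
  exact ⟨hstable, fun hμ₀ hη => hstable (by rw [hμ₀, mul_zero]; positivity)⟩
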